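/- Let $B$ and $B'$ be simple stationary 0-1 Bratteli diagrams. Thus $B$ has the same finite vertex set $V$ on every level $n\ge 1$, the same finite edge set $E$ between any two consecutive levels below the first, with surjective source and range maps $s,r:E\to V$ and at most one edge between two vertices, and exactly one edge from the top vertex $v_0$ to each $v\in V$; simplicity means that for some $k\geq 1$ any two vertices $v,w\in V$ are joined by a path of $k$ edges. Similarly for $B'$, with edge set $E'$. Let $X_B$ be the space of infinite paths $x=(x_0,x_1,x_2,\dots)$ starting at $v_0$, with the topology generated by the cylinder sets. For $e\in E$ put $D_e=\{y\in X_B: s(y_1)=r(e)\}$, $R_e=\{y\in X_B: y_1=e\}$, and let $\sigma_e:D_e\to R_e$, $\sigma_e(y)=(y_0',e,y_1,y_2,\dots)$, where $y_0'$ is the edge from $v_0$ to $s(e)$; define $D'_{e'},R'_{e'},\sigma'_{e'}$ on $X_{B'}$ in the same way. Let $\alpha:E\to E'$ be an admissible bijection, that is, $r(e)=s(f)\iff r(\alpha(e))=s(\alpha(f))$ for all $e,f\in E$, and let $\overline\alpha:X_B\to X_{B'}$, $\overline\alpha(x)=(y_0,\alpha(x_1),\alpha(x_2),\dots)$, where $y_0$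 is the edge from $v_0$ to $s(\alpha(x_1))$. Then $\overline\alpha$ is a homeomorphism, it maps $R_e$ onto $R'_{\alpha(e)}$ and $D_e$ onto $D'_{\alpha(e)}$, and $\overline\alpha\circ\sigma_e=\sigma'_{\alpha(e)}\circ\overline\alpha$ on $D_e$, for every $e\in E$. Moreover, let $m$ and $m'$ be non-atomic Borel probability measures on $X_B$ and $X_{B'}$. A Markov measure $m(P_n)$ is given by stochastic matrices $P_n=(p^{(n)}_{v,e})_{n\ge 0}$ with $p^{(n)}_{v,e}>0\iff s(e)=v$ and $\sum_{e: s(e)=v}p^{(n)}_{v,e}=1$ through $m([(e_0,\dots,e_n)])=p^{(0)}_{v_0,e_0}p^{(1)}_{s(e_1),e_1}\cdots p^{(n)}_{s(e_n),e_n}$; it is stationary if $P_n=P$ for all $n\ge1$. A measure is invariant for tail equivalence if any two cylinder sets given by finite paths from $v_0$ to the same vertex of the same level have the same measure. We say that $\{\sigma_e\}$ is a (saturated, (C-K)) semibranching function system (s.f.s.) on $(X_B,m)$ if the ranges $R_e$ partition $X_B$ mod $0$, $m\circ\sigma_e\ll m$ on $D_e$ with a.e. positive density, there is a measurable $\sigma:X_B\to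 X_B$ with $\sigma\circ\sigma_e=\mathrm{id}$ a.e. on $D_e$, the sets $D_e$ cover $X_B$ mod $0$, and each $D_e$ is mod $0$ a union of sets $R_f$. We say that $\overline\alpha$ implements an isomorphism of $\{\sigma_e: e\in E\}$ on $(X_B,m)$ and $\{\sigma'_{\alpha(e)}: e\in E\}$ on $(X_{B'},m')$ if both are s.f.s. in this sense, $\overline\alpha$ maps $R_e$ bijectively (mod $0$) onto $R'_{\alpha(e)}$, the measures $m'\circ\overline\alpha$ and $m$ are equivalent on each $R_e$, and $\overline\alpha\circ\sigma_e=\sigma'_{\alpha(e)}\circ\overline\alpha$ a.e. on each $D_e$. Then: 1. If $m$ and $m'$ are invariant for the tail equivalence relations of $B$ and $B'$, then $\overline\alpha$ implements an isomorphism if and only if $m'\circ\overline\alpha=m$. 2. If $m=\nu(P)$ and $m'=\nu(P')$ are stationary Markov measures, then $\overline\alpha$ implements an isomorphism if and only if $p'_{s(\alpha(e)),\alpha(e)}=p_{s(e),e}$ for every $e\in E$. 3. If $m=m(P_n)$ and $m'=m(P_n')$ are Markov measures for which $\{\sigma_e\}$ and $\{\sigma'_{e'}\}$ are s.f.s. on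 $(X_B,m)$ and $(X_{B'},m')$, then $\overline\alpha$ implements an isomorphism if and only if, for almost every $x\in X_B$, both with respect to $m$ and with respect to $m'\circ\overline\alpha$, $$\prod_{i=1}^\infty\frac{(p')^{(i)}_{s(\alpha(x_i)),\alpha(x_i)}}{p^{(i)}_{s(x_i),x_i}}\quad\text{converges to a value in }(0,\infty).$$ Consequently, for Markov measures $m$ and $m'$ for which $\{\sigma_e\}$ and $\{\sigma'_{e'}\}$ are s.f.s., $\overline\alpha$ implements an isomorphism if and only if at least one of the following holds: $m,m'$ are invariant and $m'\circ\overline\alpha=m$; $m,m'$ are stationary Markov measures with $p'_{s(\alpha(e)),\alpha(e)}=p_{s(e),e}$ for all $e$; $m,m'$ are Markov measures with the product condition of 3. -/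

import Mathlib

open Set Filter Topology MeasureTheory
open scoped ENNReal

/-! ## Stationary 0-1 Bratteli diagrams and their path spaces -/

/-- A stationary 0-1 Bratteli diagram. `V` is the set of vertices of every level `V₁, V₂, …`, and
`E` is the set of edges between two consecutive levels below the first one, with source map `s` and
range map `r`. The top vertex `v₀` is joined to each `v : V` by exactly one edge, so that the edges
of the first level need not be listed: such an edge is identified with its end `v : V`.
The incidence matrix has entries `0` and `1`: there is at most one edge between two vertices. -/
structure ZeroOneBratteli (V E : Type*) where
  /-- the source map -/
  s : E → V
  /-- the range map -/
  r : E → V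
  s_surjective : Function.Surjective s
  r_surjective : Function.Surjective r
  eq_of_s_eq_of_r_eq : ∀ e f : E, s e = s f → r e = r f → e = f

namespace ZeroOneBratteli

variable {V E V' E' : Type*}

/-- `B.Connected k v w`: there is a path of `k` edges from `v` (on some level `n ≥ 1`)
to `w` (on level `n + k`). -/
def Connected (B : ZeroOneBratteli V E) : ℕ → V → V → Prop
  | 0, v, w => v = w
  | k + 1, v, w => ∃ e : E, B.s e = v ∧ B.Connected k (B.r e) w

/-- The diagram is simple: for every level `n ≥ 1` there is a level `m > n` such that any vertex of
level `n` is connected to any vertex of level `m` by a path. -/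
def IsSimple (B : ZeroOneBratteli V E) : Prop :=
  ∀ n : ℕ, 0 < n → ∃ m : ℕ, n < m ∧ ∀ v w : V, B.Connected (m - n) v w

/-- The path space `X_B` of infinite paths `x = (x₀, x₁, x₂, …)` that start at `v₀`.
The component `x.1.1` is the edge `x₀` (identified with its range in `V`),
and `x.1.2 i` is the edge `x_{i+1}`. -/
def PathSpace (B : ZeroOneBratteli V E) : Type _ :=
  {x : V × (ℕ → E) // x.1 = B.s (x.2 0) ∧ ∀ i, B.r (x.2 i) = B.s (x.2 (i + 1))}

/-- The first edge `x₀` of a path (identified with its range). -/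
def PathSpace.init {B : ZeroOneBratteli V E} (x : B.PathSpace) : V := x.1.1

/-- `x.edge i` is the edge `x_{i+1}` of the path `x`. -/
def PathSpace.edge {B : ZeroOneBratteli V E} (x : B.PathSpace) (i : ℕ) : E := x.1.2 i

/-- The cylinder set `[(y₀, y₁, …, y_n)]`. Every finite path that starts at `v₀` is an initial
segment of some infinite path `y`, so these are all the cylinder sets. -/
def cylinder (B : ZeroOneBratteli V E) (y : B.PathSpace) (n : ℕ) : Set B.PathSpace :=
  {x | x.init = y.init ∧ ∀ i < n, x.edge i = y.edge i}

/-- The topology on `X_B` generated by the cylinder sets. -/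
instance (B : ZeroOneBratteli V E) : TopologicalSpace B.PathSpace :=
  TopologicalSpace.generateFrom {C | ∃ y n, C = B.cylinder y n}

instance (B : ZeroOneBratteli V E) : MeasurableSpace B.PathSpace := borel _

instance (B : ZeroOneBratteli V E) : BorelSpace B.PathSpace := ⟨rfl⟩

/-! ## The edge semibranching function system -/

/-- `D_e = {y : s(y₁) = r(e)}`. -/
def D (B : ZeroOneBratteli V E) (e : E) : Set B.PathSpace :=
  {y | B.s (y.edge 0) = B.r e}

/-- `R_e = {y : y₁ = e}`. -/
def R (B : ZeroOneBratteli V E) (e : E) : Set B.PathSpace :=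
  {y | y.edge 0 = e}

/-- `σ_e (y) = (y₀', e, y₁, y₂, …)` for `y ∈ D_e`, where `y₀'` is the edge from `v₀` to `s(e)`. -/
def sigma (B : ZeroOneBratteli V E) (e : E) (y : B.D e) : B.PathSpace :=
  ⟨(B.s e, fun i => Nat.casesOn i e y.1.edge), rfl, fun i => by
    cases i with
    | zero => exact y.2.symm
    | succ i => exact y.1.2.2 i⟩

/-! ## Measures on the path space -/

/-- `m` is invariant with respect to tail equivalence: two cylinder sets given by finite paths from
`v₀` to the same vertex of the same level have the same measure. The range of the
last edge of `(y₀, …, y_n)` is the source of `y_{n+1}`. -/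
def IsTailInvariant (B : ZeroOneBratteli V E) (m : Measure B.PathSpace) : Prop :=
  ∀ (n : ℕ) (y z : B.PathSpace), B.s (y.edge n) = B.s (z.edge n) →
    m (B.cylinder y n) = m (B.cylinder z n)

/-- A sequence of stochastic matrices `P₀, P₁, P₂, …` on the diagram: `p₀ v` is the entry of the row
vector `P₀` at the edge from `v₀` to `v`, and `p n v e` is the entry `p^{(n+1)}_{v,e}` of
`P_{n+1}`. -/
structure MarkovData (B : ZeroOneBratteli V E) [Fintype V] [Fintype E] where
  p₀ : V → ℝ
  p : ℕ → V → E → ℝ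
  p₀_pos : ∀ v, 0 < p₀ v
  p₀_sum : ∑ v, p₀ v = 1
  p_nonneg : ∀ n v e, 0 ≤ p n v e
  p_pos_iff : ∀ n v e, 0 < p n v e ↔ B.s e = v
  p_sum : ∀ n v, ∑ e, p n v e = 1

/-- All the matrices `P₁, P₂, …` are the same. -/
def MarkovData.IsStationary {B : ZeroOneBratteli V E} [Fintype V] [Fintype E]
    (P : B.MarkovData) : Prop :=
  ∀ n, P.p n = P.p 0

/-- `m` is the Markov measure `m(P_n)`:
`m([(e₀, …, e_n)]) = p^{(0)}_{v₀,e₀} p^{(1)}_{s(e₁),e₁} ⋯ p^{(n)}_{s(e_n),e_n}`. -/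
def IsMarkovMeasure {B : ZeroOneBratteli V E} [Fintype V] [Fintype E]
    (m : Measure B.PathSpace) (P : B.MarkovData) : Prop :=
  ∀ (y : B.PathSpace) (n : ℕ), m (B.cylinder y n) =
    ENNReal.ofReal (P.p₀ y.init * ∏ i ∈ Finset.range n, P.p i (B.s (y.edge i)) (y.edge i))

/-! ## Admissible maps -/

/-- A bijection of the edge sets that preserves the linked pairs in both directions. -/
def IsAdmissible (B : ZeroOneBratteli V E) (B' : ZeroOneBratteli V' E') (α : E ≃ E') : Prop :=
  ∀ e f : E, B.r e = B.s f ↔ B'.r (α e) = B'.s (α f)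

/-- The induced map of path spaces, `x ↦ (y₀, α(x₁), α(x₂), …)`, where `y₀` is the edge
from `v₀` to `s(α(x₁))`. -/
def alphaBar {B : ZeroOneBratteli V E} {B' : ZeroOneBratteli V' E'} {α : E ≃ E'}
    (hα : IsAdmissible B B' α) (x : B.PathSpace) : B'.PathSpace :=
  ⟨(B'.s (α (x.edge 0)), fun i => α (x.edge i)), rfl, fun i =>
    (hα (x.edge i) (x.edge (i + 1))).mp (x.2.2 i)⟩

/-- For the path `x`, the infinite product over `i ≥ 1` of
`(p')^{(i)}_{s(α(x_i)),α(x_i)} / p^{(i)}_{s(x_i),x_i}` converges to a value in `(0,∞)`. -/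
def RatioProductConverges {B : ZeroOneBratteli V E} {B' : ZeroOneBratteli V' E'}
    [Fintype V] [Fintype E] [Fintype V'] [Fintype E'] (α : E ≃ E')
    (P : B.MarkovData) (P' : B'.MarkovData) (x : B.PathSpace) : Prop :=
  ∃ L : ℝ, 0 < L ∧ Tendsto (fun n => ∏ i ∈ Finset.range n,
    P'.p i (B'.s (α (x.edge i))) (α (x.edge i)) / P.p i (B.s (x.edge i)) (x.edge i)) atTop (𝓝 L)

end ZeroOneBratteli

/-! ## Semibranching function systems -/

/-- The finite family of maps `σ i : D i → X`, with ranges `R_i = range (σ i)`, is a semibranching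
function system on the probability space `(X, m)`, with `m` non-atomic. For Borel maps between
standard Borel spaces, a measurable embedding is the same as a one-to-one measurable map. The measure
`m ∘ σ_i` on `D i` is `m.comap (σ i)`, and `m` on `D i` is `m.comap Subtype.val`. -/
structure IsSFS {X Λ : Type*} [MeasurableSpace X] [Finite Λ] (m : Measure X)
    (D : Λ → Set X) (σ : ∀ i, D i → X) : Prop where
  prob : IsProbabilityMeasure m
  nonatomic : ∀ x, m {x} = 0
  measurableSet : ∀ i, MeasurableSet (D i)
  embedding : ∀ i, MeasurableEmbedding (σ i)
  disjoint : ∀ i j, i ≠ j → m (range (σ i) ∩ range (σ j)) = 0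
  cover : m (⋃ i, range (σ i))ᶜ = 0
  ac : ∀ i, m.comap (σ i) ≪ m.comap (Subtype.val : D i → X)
  rnDeriv_pos : ∀ i, ∀ᵐ x ∂(m.comap (Subtype.val : D i → X)),
    0 < (m.comap (σ i)).rnDeriv (m.comap (Subtype.val : D i → X)) x
  coding : ∃ c : X → X, Measurable c ∧
    ∀ i, ∀ᵐ x ∂(m.comap (Subtype.val : D i → X)), c (σ i x) = x

/-- A saturated semibranching function system with condition (C-K). -/
structure IsSaturatedCKSFS {X Λ : Type*} [MeasurableSpace X] [Finite Λ] (m : Measure X)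
    (D : Λ → Set X) (σ : ∀ i, D i → X) : Prop extends IsSFS m D σ where
  saturated : m (⋃ i, D i)ᶜ = 0
  ck : ∀ i, ∃ J : Set Λ, D i =ᵐ[m] ⋃ j ∈ J, range (σ j)

/-- The map `F : X → X'` implements an isomorphism of the saturated semibranching function systems
`{σ i}` on `(X, m)` and `{σ' i}` on `(X', m')`: its restrictions `φ_i` to the sets
`R_i = range (σ i)` are (mod 0) one-to-one and onto `R'_i`, the measures `m' ∘ φ_i` and `m` on `R_i`
are equivalent (they have the same null sets), and `F ∘ σ_i = σ'_i ∘ F` a.e. on `D_i`. -/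
structure ImplementsSFSIso {X X' Λ : Type*} [MeasurableSpace X] [MeasurableSpace X'] [Finite Λ]
    (m : Measure X) (D : Λ → Set X) (σ : ∀ i, D i → X)
    (m' : Measure X') (D' : Λ → Set X') (σ' : ∀ i, D' i → X') (F : X → X') : Prop where
  sfs : IsSaturatedCKSFS m D σ
  sfs' : IsSaturatedCKSFS m' D' σ'
  measurable : Measurable F
  injOn : ∀ i, ∃ N : Set X, m N = 0 ∧ InjOn F (range (σ i) \ N)
  onto : ∀ i, F '' range (σ i) =ᵐ[m'] range (σ' i)
  equiv : ∀ i, ∀ A ⊆ range (σ i), MeasurableSet A → (m' (F '' A) = 0 ↔ m A = 0)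
  comm : ∀ i, ∀ᵐ x ∂(m.comap (Subtype.val : D i → X)),
    ∃ h : F x.1 ∈ D' i, F (σ i x) = σ' i ⟨F x.1, h⟩

/-- `ᾱ` implements the isomorphism of the edge systems `{σ_e : e ∈ E}` on `(X_B, m)` and
`{σ'_{α(e)} : e ∈ E}` on `(X_{B'}, m')`. -/
def ZeroOneBratteli.AlphaBarImplements {V E V' E' : Type*} [Finite E]
    {B : ZeroOneBratteli V E} {B' : ZeroOneBratteli V' E'} {α : E ≃ E'}
    (hα : ZeroOneBratteli.IsAdmissible B B' α)
    (m : Measure B.PathSpace) (m' : Measure B'.PathSpace) : Prop :=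
  ImplementsSFSIso m B.D B.sigma m' (fun e => B'.D (α e)) (fun e => B'.sigma (α e))
    (ZeroOneBratteli.alphaBar hα)

/-!
An admissible bijection of the edges comes from an isomorphism of the two diagrams, because any two
edges with the same source follow a common edge (`IsAdmissible.s_eq_iff`). So `ᾱ` is a
homeomorphism that carries cylinders to cylinders and intertwines the edge systems, and it
implements an isomorphism exactly when both edge systems are semibranching function systems and `m`
is equivalent to `m' ∘ ᾱ` (`alphaBarImplements_of_equiv`, `AlphaBarImplements.comap_eq_zero_iff`).
What remains is to recognize equivalence of measures from their values on cylinders.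

The tool for this is `measure_le_mul_of_frequently_cylinder`: if `ν ≤ a μ` on arbitrarily small
cylinders around each point of `A`, then `ν A ≤ a μ A`. It yields a differentiation theorem: if
`μ ≪ ν`, the ratios `ν(C_n(x)) / μ(C_n(x))` on the cylinders `C_n(x)` around `x` converge to a
positive finite value for `μ`-almost every `x`, and conversely `ν ≪ μ` if these ratios have finite
limits `ν`-almost everywhere. For Markov measures the ratios are the partial products of the
infinite product, up to a constant factor
(`IsMarkovMeasure.ratioProductConverges_iff`), which is the general Markov case.

For stationary Markov measures, the factors of the product take finitely many values and tend to
`1`, while almost every path runs through every edge infinitely often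
(`IsMarkovMeasure.ae_frequently_edge_eq`); hence every factor equals `1`.

For invariant measures, the measures `h_n(v)` of the cylinders that end at the vertex `v` of a level
satisfy `h_n = T h_{n+1}` with the incidence operator `T`. As the diagram is simple, the nonnegative
solutions are unique up to a factor (`IsHarmonic.exists_eq_mul`). This makes the invariant
probability measure unique (`IsTailInvariant.unique`), so that `m' ∘ ᾱ = m`, and it makes `h_{n+1}`
a multiple of `h_n`, so that each `σ_e` scales `m` by a constant and the edge system is a
semibranching function system (`IsTailInvariant.isSaturatedCKSFS`).
-/

/-! ### Paths and cylinder sets -/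

namespace ZeroOneBratteli

variable {V E V' E' : Type*} {B : ZeroOneBratteli V E} {B' : ZeroOneBratteli V' E'}

namespace PathSpace

theorem init_eq (x : B.PathSpace) : x.init = B.s (x.edge 0) := x.2.1

theorem r_edge (x : B.PathSpace) (i : ℕ) : B.r (x.edge i) = B.s (x.edge (i + 1)) := x.2.2 i

@[ext]
theorem ext {x y : B.PathSpace} (h : ∀ i, x.edge i = y.edge i) : x = y := by
  have h1 : x.1.2 = y.1.2 := funext h
  exact Subtype.ext (Prod.ext (by rw [x.2.1, y.2.1, h1]) h1)

/-- The path with a given sequence of edges below the first level. -/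
def ofEdges (f : ℕ → E) (hf : ∀ i, B.r (f i) = B.s (f (i + 1))) : B.PathSpace :=
  ⟨(B.s (f 0), f), rfl, hf⟩

@[simp]
theorem edge_ofEdges (f : ℕ → E) (hf : ∀ i, B.r (f i) = B.s (f (i + 1))) (i : ℕ) :
    (ofEdges f hf).edge i = f i := rfl

/-- The path that follows `y` down to level `n + 1` and then continues as the path `x`. -/
def splice (y x : B.PathSpace) (n : ℕ) (h : B.s (y.edge n) = B.s (x.edge 0)) : B.PathSpace :=
  ofEdges (fun i => if i < n then y.edge i else x.edge (i - n)) fun i => by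
    rcases lt_trichotomy (i + 1) n with hi | hi | hi
    · simp only [hi, show i < n by omega, if_true]
      exact y.r_edge i
    · subst hi
      simp only [lt_add_one, if_true, lt_irrefl, if_false, Nat.sub_self]
      rw [y.r_edge i, h]
    · simp only [show ¬ i < n by omega, show ¬ i + 1 < n by omega, if_false,
        show i + 1 - n = (i - n) + 1 by omega]
      exact x.r_edge _

theorem splice_edge_of_lt {y x : B.PathSpace} {n : ℕ} (h : B.s (y.edge n) = B.s (x.edge 0))
    {i : ℕ} (hi : i < n) : (splice y x n h).edge i = y.edge i := by
  simp [splice, hi]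

theorem splice_edge_add {y x : B.PathSpace} {n : ℕ} (h : B.s (y.edge n) = B.s (x.edge 0))
    (i : ℕ) : (splice y x n h).edge (n + i) = x.edge i := by
  simp [splice]

theorem exists_edge_zero_eq (B : ZeroOneBratteli V E) (e : E) :
    ∃ x : B.PathSpace, x.edge 0 = e := by
  choose next hnext using fun e => B.s_surjective (B.r e)
  exact ⟨ofEdges (fun n => next^[n] e) fun i => by
    rw [Function.iterate_succ_apply', hnext], rfl⟩

theorem exists_edge_eq (B : ZeroOneBratteli V E) (n : ℕ) (e : E) :
    ∃ x : B.PathSpace, x.edge n = e := by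
  induction n generalizing e with
  | zero => exact exists_edge_zero_eq B e
  | succ n ih =>
    obtain ⟨f, hf⟩ := B.r_surjective (B.s e)
    obtain ⟨x, hx⟩ := ih f
    obtain ⟨z, hz⟩ := exists_edge_zero_eq B e
    refine ⟨splice x z (n + 1) (by rw [← x.r_edge, hx, hf, hz]), ?_⟩
    exact (splice_edge_add _ 0).trans hz

theorem exists_s_edge_eq (B : ZeroOneBratteli V E) (n : ℕ) (v : V) :
    ∃ x : B.PathSpace, B.s (x.edge n) = v := by
  obtain ⟨e, rfl⟩ := B.s_surjective v
  obtain ⟨x, hx⟩ := exists_edge_eq B n e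
  exact ⟨x, by rw [hx]⟩

theorem exists_of_connected {k : ℕ} {v : V} {e : E} (h : B.Connected k v (B.s e)) :
    ∃ x : B.PathSpace, B.s (x.edge 0) = v ∧ x.edge k = e := by
  induction k generalizing v with
  | zero =>
    obtain ⟨x, hx⟩ := exists_edge_zero_eq B e
    exact ⟨x, by rw [hx]; exact h.symm, hx⟩
  | succ k ih =>
    obtain ⟨f, rfl, hf⟩ := h
    obtain ⟨x, hx, hk⟩ := ih hf
    exact ⟨B.sigma f ⟨x, hx⟩, rfl, hk⟩

/-- The path with its first edge below the top level removed. -/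
def shift (x : B.PathSpace) : B.PathSpace :=
  ofEdges (fun i => x.edge (i + 1)) fun i => x.r_edge (i + 1)

end PathSpace

theorem mem_cylinder {x y : B.PathSpace} {n : ℕ} :
    x ∈ B.cylinder y n ↔ x.init = y.init ∧ ∀ i < n, x.edge i = y.edge i := Iff.rfl

theorem mem_cylinder_self (x : B.PathSpace) (n : ℕ) : x ∈ B.cylinder x n :=
  ⟨rfl, fun _ _ => rfl⟩

theorem mem_cylinder_of_s_edge_eq {x y : B.PathSpace} {n : ℕ}
    (h0 : B.s (x.edge 0) = B.s (y.edge 0)) (h : ∀ i < n, x.edge i = y.edge i) :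
    x ∈ B.cylinder y n :=
  ⟨by rw [x.init_eq, y.init_eq, h0], h⟩

theorem s_edge_eq_of_mem_cylinder {x y : B.PathSpace} {n i : ℕ} (h : x ∈ B.cylinder y n)
    (hi : i ≤ n) : B.s (x.edge i) = B.s (y.edge i) := by
  cases i with
  | zero => rw [← x.init_eq, ← y.init_eq, h.1]
  | succ i => rw [← x.r_edge, ← y.r_edge, h.2 i hi]

theorem cylinder_eq_of_mem {x y : B.PathSpace} {n : ℕ} (h : x ∈ B.cylinder y n) :
    B.cylinder x n = B.cylinder y n := by
  ext z
  simp only [mem_cylinder, h.1]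
  refine and_congr_right fun _ => forall₂_congr fun i hi => ?_
  rw [h.2 i hi]

theorem cylinder_antitone (x : B.PathSpace) : Antitone (B.cylinder x) :=
  fun _ _ hmn _ hz => ⟨hz.1, fun i hi => hz.2 i (hi.trans_le hmn)⟩

theorem splice_mem_cylinder {y x : B.PathSpace} {n : ℕ} (h : B.s (y.edge n) = B.s (x.edge 0)) :
    PathSpace.splice y x n h ∈ B.cylinder y n := by
  refine mem_cylinder_of_s_edge_eq ?_ fun i hi => PathSpace.splice_edge_of_lt h hi
  rcases Nat.eq_zero_or_pos n with rfl | hn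
  · rw [h]
    exact congrArg B.s (PathSpace.splice_edge_add h 0)
  · rw [PathSpace.splice_edge_of_lt h hn]

/-- Any finite path can be continued by any edge that starts at its end. -/
theorem exists_mem_cylinder_edge_eq (y : B.PathSpace) (n : ℕ) {e : E}
    (he : B.s e = B.s (y.edge n)) : ∃ z ∈ B.cylinder y n, z.edge n = e := by
  obtain ⟨x, rfl⟩ := PathSpace.exists_edge_zero_eq B e
  exact ⟨_, splice_mem_cylinder he.symm, PathSpace.splice_edge_add he.symm 0⟩

theorem finite_setOf_cylinder [Finite V] [Finite E] (B : ZeroOneBratteli V E) (n : ℕ) :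
    (range fun y : B.PathSpace => B.cylinder y n).Finite := by
  let F : V × (Fin n → E) → Set B.PathSpace :=
    fun q => {x | x.init = q.1 ∧ ∀ i : Fin n, x.edge i = q.2 i}
  refine (finite_range F).subset ?_
  rintro _ ⟨y, rfl⟩
  refine ⟨(y.init, fun i => y.edge i), ?_⟩
  ext x
  exact and_congr_right fun _ => ⟨fun h i hi => h ⟨i, hi⟩, fun h i => h i i.2⟩

theorem countable_setOf_cylinder [Finite V] [Finite E] (B : ZeroOneBratteli V E) :
    {C | ∃ y n, C = B.cylinder y n}.Countable := by
  have h : {C | ∃ y n, C = B.cylinder y n} =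
      ⋃ n : ℕ, range fun y : B.PathSpace => B.cylinder y n := by
    ext C
    simp only [mem_ofPred_eq, mem_iUnion, mem_range]
    exact ⟨fun ⟨y, n, h⟩ => ⟨n, y, h.symm⟩, fun ⟨n, y, h⟩ => ⟨y, n, h.symm⟩⟩
  rw [h]
  exact countable_iUnion fun n => (finite_setOf_cylinder B n).countable

/-! ### The topology of the path space -/

theorem isOpen_cylinder (y : B.PathSpace) (n : ℕ) : IsOpen (B.cylinder y n) :=
  TopologicalSpace.isOpen_generateFrom_of_mem ⟨y, n, rfl⟩

theorem measurableSet_cylinder (y : B.PathSpace) (n : ℕ) : MeasurableSet (B.cylinder y n) :=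
  (isOpen_cylinder y n).measurableSet

theorem isOpen_iff_cylinder {U : Set B.PathSpace} :
    IsOpen U ↔ ∀ x ∈ U, ∃ n, B.cylinder x n ⊆ U := by
  constructor
  · intro hU
    induction hU with
    | basic C hC =>
      obtain ⟨y, n, rfl⟩ := hC
      exact fun x hx => ⟨n, (cylinder_eq_of_mem hx).subset⟩
    | univ => exact fun x _ => ⟨0, subset_univ _⟩
    | inter s t _ _ hs ht =>
      rintro x ⟨hxs, hxt⟩
      obtain ⟨i, hi⟩ := hs x hxs
      obtain ⟨j, hj⟩ := ht x hxt
      exact ⟨max i j, subset_inter ((cylinder_antitone x (le_max_left _ _)).trans hi)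
        ((cylinder_antitone x (le_max_right _ _)).trans hj)⟩
    | sUnion S _ ih =>
      rintro x ⟨s, hs, hxs⟩
      obtain ⟨n, hn⟩ := ih s hs x hxs
      exact ⟨n, hn.trans (subset_sUnion_of_mem hs)⟩
  · intro h
    rw [isOpen_iff_forall_mem_open]
    intro x hx
    obtain ⟨n, hn⟩ := h x hx
    exact ⟨_, hn, isOpen_cylinder x n, mem_cylinder_self x n⟩

theorem nhds_hasBasis_cylinder (x : B.PathSpace) :
    (𝓝 x).HasBasis (fun _ : ℕ => True) (B.cylinder x) := by
  refine ⟨fun t => ⟨fun ht => ?_, ?_⟩⟩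
  · obtain ⟨U, hUt, hU, hx⟩ := mem_nhds_iff.mp ht
    obtain ⟨n, hn⟩ := isOpen_iff_cylinder.mp hU x hx
    exact ⟨n, trivial, hn.trans hUt⟩
  · rintro ⟨n, -, hn⟩
    exact mem_of_superset ((isOpen_cylinder x n).mem_nhds (mem_cylinder_self x n)) hn

theorem isClosed_cylinder (y : B.PathSpace) (n : ℕ) : IsClosed (B.cylinder y n) := by
  rw [← isOpen_compl_iff, isOpen_iff_cylinder]
  exact fun x hx => ⟨n, fun z hz hzy => hx <| by
    rw [← cylinder_eq_of_mem hzy, cylinder_eq_of_mem hz]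
    exact mem_cylinder_self x n⟩

instance : RegularSpace B.PathSpace :=
  RegularSpace.of_hasBasis nhds_hasBasis_cylinder fun x n _ => isClosed_cylinder x n

instance [Finite V] [Finite E] : SecondCountableTopology B.PathSpace :=
  ⟨⟨_, countable_setOf_cylinder B, rfl⟩⟩

instance [Finite V] [Finite E] : TopologicalSpace.PseudoMetrizableSpace B.PathSpace :=
  TopologicalSpace.PseudoMetrizableSpace.of_regularSpace_secondCountableTopology _

theorem continuous_shift : Continuous (PathSpace.shift (B := B)) := by
  rw [continuous_iff_continuousAt]
  intro x
  refine ((nhds_hasBasis_cylinder x).tendsto_iff (nhds_hasBasis_cylinder _)).mpr fun n _ =>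
    ⟨n + 1, trivial, fun y hy => mem_cylinder_of_s_edge_eq ?_ fun i hi => ?_⟩
  · exact s_edge_eq_of_mem_cylinder (i := 1) hy (Nat.succ_le_succ (Nat.zero_le n))
  · exact hy.2 (i + 1) (by omega)

end ZeroOneBratteli

/-! ### Comparison of measures along shrinking cylinders -/

namespace ZeroOneBratteli

variable {V E : Type*} {B : ZeroOneBratteli V E} [Finite V] [Finite E]

/-- The differentiation principle behind all statements on densities: if every point of `A` has
arbitrarily small cylinders on which `ν ≤ a μ`, then `ν A ≤ a μ A`. The largest such cylinders
inside an open neighbourhood of `A` are pairwise disjoint and cover `A`. -/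
theorem measure_le_mul_of_frequently_cylinder {μ ν : Measure B.PathSpace} [IsFiniteMeasure μ]
    {a : ℝ≥0∞} (ha : a ≠ ∞) {A : Set B.PathSpace}
    (h : ∀ x ∈ A, ∃ᶠ n in atTop, ν (B.cylinder x n) ≤ a * μ (B.cylinder x n)) :
    ν A ≤ a * μ A := by
  have key : ∀ U, A ⊆ U → IsOpen U → ν A ≤ a * μ U := by
    intro U hAU hU
    have h1 : ∀ x ∈ A, ∃ n, B.cylinder x n ⊆ U ∧ ν (B.cylinder x n) ≤ a * μ (B.cylinder x n) := by
      intro x hx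
      obtain ⟨n, hn⟩ := isOpen_iff_cylinder.mp hU x (hAU hx)
      have h2 : ∀ᶠ k in atTop, B.cylinder x k ⊆ U :=
        (eventually_ge_atTop n).mono fun k hk => (cylinder_antitone x hk).trans hn
      obtain ⟨k, hk, hk'⟩ := ((h x hx).and_eventually h2).exists
      exact ⟨k, hk', hk⟩
    have h2 : ∀ x ∈ A, ∃ n, (B.cylinder x n ⊆ U ∧
        ν (B.cylinder x n) ≤ a * μ (B.cylinder x n)) ∧
        ∀ k < n, ¬ (B.cylinder x k ⊆ U ∧ ν (B.cylinder x k) ≤ a * μ (B.cylinder x k)) := by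
      classical
      exact fun x hx => ⟨Nat.find (h1 x hx), Nat.find_spec (h1 x hx), fun k => Nat.find_min _⟩
    choose! N hN hmin using h2
    let S : Set (Set B.PathSpace) := {C | ∃ x ∈ A, C = B.cylinder x (N x)}
    have hcount : S.Countable := (countable_setOf_cylinder B).mono <| by
      rintro _ ⟨x, _, rfl⟩
      exact ⟨x, N x, rfl⟩
    -- two of the cylinders that meet are nested, so the smaller one is not minimal in its choice
    have hnest : ∀ x ∈ A, ∀ y ∈ A, N x ≤ N y →
        ¬ Disjoint (B.cylinder x (N x)) (B.cylinder y (N y)) →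
        B.cylinder x (N x) = B.cylinder y (N y) := by
      intro x hx y hy hxy hd
      obtain ⟨z, hzx, hzy⟩ := not_disjoint_iff.mp hd
      have e1 : B.cylinder y (N x) = B.cylinder x (N x) := by
        rw [← cylinder_eq_of_mem hzx, cylinder_eq_of_mem (cylinder_antitone y hxy hzy)]
      have e2 : N x = N y := by
        refine le_antisymm hxy (not_lt.mp fun hlt => hmin y hy _ hlt ?_)
        rw [e1]
        exact hN x hx
      rw [← e1, e2]
    have hdisj : S.PairwiseDisjoint id := by
      rintro _ ⟨x, hx, rfl⟩ _ ⟨y, hy, rfl⟩ hne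
      by_contra hd
      rcases le_total (N x) (N y) with hxy | hxy
      · exact hne (hnest x hx y hy hxy hd)
      · exact hne (hnest y hy x hx hxy fun h => hd h.symm).symm
    have hcover : A ⊆ ⋃₀ S := fun x hx => ⟨_, ⟨x, hx, rfl⟩, mem_cylinder_self x _⟩
    have hmeas : ∀ C ∈ S, MeasurableSet C := by
      rintro _ ⟨x, _, rfl⟩
      exact measurableSet_cylinder x _
    have := hcount.to_subtype
    calc ν A ≤ ν (⋃₀ S) := measure_mono hcover
      _ = ∑' C : S, ν C := measure_sUnion hcount hdisj hmeas
      _ ≤ ∑' C : S, a * μ C := by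
        refine ENNReal.tsum_le_tsum ?_
        rintro ⟨_, x, hx, rfl⟩
        exact (hN x hx).2
      _ = a * μ (⋃₀ S) := by rw [ENNReal.tsum_mul_left, measure_sUnion hcount hdisj hmeas]
      _ ≤ a * μ U := by
        gcongr
        rintro y ⟨_, ⟨x, hx, rfl⟩, hy⟩
        exact (hN x hx).1 hy
  refine ENNReal.le_of_forall_pos_le_add fun ε hε _ => ?_
  obtain ⟨U, hAU, hU, hμ⟩ := A.exists_isOpen_le_add μ (ε := ε / a)
    (ENNReal.div_ne_zero.mpr ⟨by simpa using hε.ne', ha⟩)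
  calc ν A ≤ a * μ U := key U hAU hU
    _ ≤ a * (μ A + ε / a) := by gcongr
    _ ≤ a * μ A + ε := by
      rw [mul_add]
      gcongr
      exact ENNReal.mul_div_le

theorem measure_ext_of_cylinder {μ ν : Measure B.PathSpace} [IsFiniteMeasure μ]
    [IsFiniteMeasure ν] (h : ∀ y n, μ (B.cylinder y n) = ν (B.cylinder y n)) : μ = ν := by
  ext A -
  apply le_antisymm
  · simpa using measure_le_mul_of_frequently_cylinder (μ := ν) (ν := μ) (a := 1) (A := A) (by simp)
      fun x _ => Frequently.of_forall fun n => by simp [h]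
  · simpa using measure_le_mul_of_frequently_cylinder (μ := μ) (ν := ν) (a := 1) (A := A) (by simp)
      fun x _ => Frequently.of_forall fun n => by simp [h]

theorem _root_.ENNReal.eq_zero_of_forall_le_mul {x K : ℝ≥0∞} (hK : K ≠ ∞)
    (h : ∀ ε : ℝ≥0∞, ε ≠ 0 → ε ≠ ∞ → x ≤ ε * K) : x = 0 := by
  refine le_antisymm (ENNReal.le_of_forall_pos_le_add fun δ hδ _ => ?_) zero_le
  rw [zero_add]
  have hK0 : K + 1 ≠ 0 := by simp
  have hK1 : K + 1 ≠ ∞ := by simp [hK]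
  calc x ≤ δ / (K + 1) * K := h _ (ENNReal.div_ne_zero.mpr ⟨by simpa using hδ.ne', hK1⟩)
        (ENNReal.div_ne_top (by simp) hK0)
    _ ≤ δ / (K + 1) * (K + 1) := by
      gcongr
      exact le_self_add
    _ = δ := ENNReal.div_mul_cancel hK0 hK1

theorem _root_.ENNReal.eq_zero_of_le_mul_of_lt_one {x c : ℝ≥0∞} (hx : x ≠ ∞) (hc : c < 1)
    (h : x ≤ c * x) : x = 0 := by
  by_contra h0
  have h1 : c * x < 1 * x := ENNReal.mul_lt_mul_left h0 hx hc
  rw [one_mul] at h1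
  exact absurd h h1.not_ge

/-- If `μ ≪ ν`, the density `dν/dμ` is `μ`-almost everywhere the limit of the ratios
on the shrinking cylinders, and it is positive and finite. -/
theorem ae_exists_tendsto_measure_div_of_absolutelyContinuous {μ ν : Measure B.PathSpace}
    [IsFiniteMeasure μ] [IsFiniteMeasure ν] (hpos : ∀ x n, μ (B.cylinder x n) ≠ 0) (hμν : μ ≪ ν) :
    ∀ᵐ x ∂μ, ∃ L : ℝ≥0∞, L ≠ 0 ∧ L ≠ ∞ ∧
      Tendsto (fun n => ν (B.cylinder x n) / μ (B.cylinder x n)) atTop (𝓝 L) := by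
  set q : B.PathSpace → ℕ → ℝ≥0∞ := fun x n => ν (B.cylinder x n) / μ (B.cylinder x n) with hq
  have hle : ∀ {a : ℝ≥0∞} {x n}, q x n ≤ a → ν (B.cylinder x n) ≤ a * μ (B.cylinder x n) :=
    fun h => (ENNReal.div_le_iff (hpos _ _) (measure_ne_top _ _)).mp h
  have hge : ∀ {b : ℝ≥0∞} {x n}, b ≠ 0 → b ≤ q x n →
      μ (B.cylinder x n) ≤ b⁻¹ * ν (B.cylinder x n) := by
    intro b x n hb h
    rw [mul_comm, ← div_eq_mul_inv]
    rw [ENNReal.le_div_iff_mul_le (Or.inl (hpos _ _)) (Or.inl (measure_ne_top _ _))] at h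
    have hbt : b ≠ ∞ := by
      rintro rfl
      rw [ENNReal.top_mul (hpos _ _)] at h
      exact measure_ne_top _ _ (top_le_iff.mp h)
    rw [ENNReal.le_div_iff_mul_le (Or.inl hb) (Or.inl hbt), mul_comm]
    exact h
  obtain ⟨s, hs, hsd⟩ := TopologicalSpace.exists_countable_dense ℝ≥0∞
  -- the set of points where the ratios cross `[a, b]` infinitely often is a null set
  have hcross : ∀ᵐ x ∂μ, ∀ a ∈ s, ∀ b ∈ s, a < b →
      ¬ ((∃ᶠ n in atTop, q x n < a) ∧ ∃ᶠ n in atTop, b < q x n) := by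
    rw [ae_ball_iff hs]
    intro a _
    rw [ae_ball_iff hs]
    intro b _
    by_cases hab : a < b
    swap
    · exact Eventually.of_forall fun x h => absurd h hab
    have hb : b ≠ 0 := (zero_le.trans_lt hab).ne'
    set S := {x | (∃ᶠ n in atTop, q x n < a) ∧ ∃ᶠ n in atTop, b < q x n} with hS
    have h1 : ν S ≤ a * μ S := measure_le_mul_of_frequently_cylinder hab.ne_top
      fun x hx => hx.1.mono fun n hn => hle hn.le
    have h2 : μ S ≤ b⁻¹ * ν S := measure_le_mul_of_frequently_cylinder
      (ENNReal.inv_ne_top.mpr hb) fun x hx => hx.2.mono fun n hn => hge hb hn.le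
    have h3 : μ S = 0 := by
      refine ENNReal.eq_zero_of_le_mul_of_lt_one (measure_ne_top _ _) (c := a / b)
        (ENNReal.div_lt_of_lt_mul (by rwa [one_mul])) (h2.trans ?_)
      calc b⁻¹ * ν S ≤ b⁻¹ * (a * μ S) := by gcongr
        _ = (a / b) * μ S := by rw [← mul_assoc, mul_comm b⁻¹, div_eq_mul_inv]
    have h4 : ∀ᵐ x ∂μ, x ∉ S := measure_eq_zero_iff_ae_notMem.mp h3
    exact h4.mono fun x hx _ => hx
  have hzero : ∀ᵐ x ∂μ, ¬ Tendsto (q x) atTop (𝓝 0) := by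
    refine hμν.ae_le (measure_eq_zero_iff_ae_notMem.mp ?_ :
      ∀ᵐ x ∂ν, x ∉ {x | Tendsto (q x) atTop (𝓝 0)})
    refine ENNReal.eq_zero_of_forall_le_mul (measure_ne_top μ {x | Tendsto (q x) atTop (𝓝 0)})
      fun ε h0 ht => measure_le_mul_of_frequently_cylinder ht fun x hx => ?_
    exact ((hx.eventually_lt_const (pos_iff_ne_zero.mpr h0)).mono fun n hn => hle hn.le).frequently
  have htop : ∀ᵐ x ∂μ, ¬ Tendsto (q x) atTop (𝓝 ∞) := by
    refine (measure_eq_zero_iff_ae_notMem.mp ?_ :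
      ∀ᵐ x ∂μ, x ∉ {x | Tendsto (q x) atTop (𝓝 ∞)})
    refine ENNReal.eq_zero_of_forall_le_mul (measure_ne_top ν {x | Tendsto (q x) atTop (𝓝 ∞)})
      fun ε h0 ht => measure_le_mul_of_frequently_cylinder ht fun x hx => ?_
    have := hx.eventually_const_lt (ENNReal.inv_lt_top.mpr (pos_iff_ne_zero.mpr h0))
    refine (this.mono fun n hn => ?_).frequently
    simpa using hge (ENNReal.inv_ne_zero.mpr ht) hn.le
  filter_upwards [hcross, hzero, htop] with x h1 h2 h3
  obtain ⟨L, hL⟩ := tendsto_of_no_upcrossings hsd h1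
  exact ⟨L, by rintro rfl; exact h2 hL, by rintro rfl; exact h3 hL, hL⟩

/-- If the ratios of `ν` to `μ` on the shrinking cylinders have finite limits `ν`-almost everywhere,
then `ν` has no part that is singular to `μ`. -/
theorem absolutelyContinuous_of_ae_tendsto_measure_div {μ ν : Measure B.PathSpace}
    [IsFiniteMeasure μ] (hpos : ∀ x n, μ (B.cylinder x n) ≠ 0)
    (h : ∀ᵐ x ∂ν, ∃ L : ℝ≥0∞, L ≠ ∞ ∧
      Tendsto (fun n => ν (B.cylinder x n) / μ (B.cylinder x n)) atTop (𝓝 L)) : ν ≪ μ := by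
  intro A hA
  let T : ℕ → Set B.PathSpace := fun K =>
    {x ∈ A | ∃ᶠ n in atTop, ν (B.cylinder x n) ≤ K * μ (B.cylinder x n)}
  have hT : ∀ K, ν (T K) = 0 := by
    intro K
    have h1 : ν (T K) ≤ K * μ (T K) :=
      measure_le_mul_of_frequently_cylinder (by simp) fun x hx => hx.2
    have h2 : μ (T K) = 0 := measure_mono_null (fun x hx => hx.1) hA
    simpa [h2] using h1
  have h1 : ∀ᵐ x ∂ν, x ∉ ⋃ K, T K := measure_eq_zero_iff_ae_notMem.mp (measure_iUnion_null hT)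
  rw [measure_eq_zero_iff_ae_notMem]
  filter_upwards [h, h1] with x hx hxT hxA
  obtain ⟨L, hL, hlim⟩ := hx
  obtain ⟨K, hK⟩ := ENNReal.exists_nat_gt hL
  refine hxT (mem_iUnion.mpr ⟨K, hxA, ?_⟩)
  refine ((hlim.eventually_lt_const hK).mono fun n hn => ?_).frequently
  exact (ENNReal.div_le_iff (hpos _ _) (measure_ne_top _ _)).mp hn.le

end ZeroOneBratteli

/-! ### The homeomorphism induced by an admissible bijection -/

namespace ZeroOneBratteli

variable {V E V' E' : Type*} {B : ZeroOneBratteli V E} {B' : ZeroOneBratteli V' E'} {α : E ≃ E'}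

theorem IsAdmissible.symm (hα : IsAdmissible B B' α) : IsAdmissible B' B α.symm := fun e f => by
  simpa using (hα (α.symm e) (α.symm f)).symm

/-- An admissible bijection respects the sources of the edges, so that it comes from an
isomorphism of diagrams: any two edges with the same source follow a common edge. -/
theorem IsAdmissible.s_eq_iff (hα : IsAdmissible B B' α) (e f : E) :
    B.s e = B.s f ↔ B'.s (α e) = B'.s (α f) := by
  obtain ⟨g, hg⟩ := B.r_surjective (B.s e)
  rw [← hg, hα g f, (hα g e).mp hg]

theorem IsAdmissible.r_eq_iff (hα : IsAdmissible B B' α) (e f : E) :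
    B.s e = B.r f ↔ B'.s (α e) = B'.r (α f) := by
  rw [eq_comm, hα f e, eq_comm]

@[simp]
theorem edge_alphaBar (hα : IsAdmissible B B' α) (x : B.PathSpace) (i : ℕ) :
    (alphaBar hα x).edge i = α (x.edge i) := rfl

theorem alphaBar_symm_alphaBar (hα : IsAdmissible B B' α) (x : B.PathSpace) :
    alphaBar hα.symm (alphaBar hα x) = x := by
  ext i
  simp

theorem alphaBar_alphaBar_symm (hα : IsAdmissible B B' α) (x : B'.PathSpace) :
    alphaBar hα (alphaBar hα.symm x) = x := by
  ext i
  simp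

theorem alphaBar_mem_cylinder (hα : IsAdmissible B B' α) {x y : B.PathSpace} {n : ℕ} :
    alphaBar hα x ∈ B'.cylinder (alphaBar hα y) n ↔ x ∈ B.cylinder y n := by
  simp only [mem_cylinder, PathSpace.init_eq, edge_alphaBar, α.injective.eq_iff, ← hα.s_eq_iff]

theorem image_alphaBar_cylinder (hα : IsAdmissible B B' α) (y : B.PathSpace) (n : ℕ) :
    alphaBar hα '' B.cylinder y n = B'.cylinder (alphaBar hα y) n := by
  ext z
  constructor
  · rintro ⟨x, hx, rfl⟩
    exact (alphaBar_mem_cylinder hα).mpr hx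
  · intro hz
    refine ⟨alphaBar hα.symm z, ?_, alphaBar_alphaBar_symm hα z⟩
    rwa [← alphaBar_mem_cylinder hα, alphaBar_alphaBar_symm]

theorem continuous_alphaBar (hα : IsAdmissible B B' α) : Continuous (alphaBar hα) := by
  rw [continuous_iff_continuousAt]
  exact fun x => ((nhds_hasBasis_cylinder x).tendsto_iff (nhds_hasBasis_cylinder _)).mpr
    fun n _ => ⟨n, trivial, fun y hy => (alphaBar_mem_cylinder hα).mpr hy⟩

/-- The map `ᾱ` as a homeomorphism. -/
def alphaBarHomeomorph (hα : IsAdmissible B B' α) : B.PathSpace ≃ₜ B'.PathSpace where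
  toFun := alphaBar hα
  invFun := alphaBar hα.symm
  left_inv := alphaBar_symm_alphaBar hα
  right_inv := alphaBar_alphaBar_symm hα
  continuous_toFun := continuous_alphaBar hα
  continuous_invFun := continuous_alphaBar hα.symm

theorem isHomeomorph_alphaBar (hα : IsAdmissible B B' α) : IsHomeomorph (alphaBar hα) :=
  (alphaBarHomeomorph hα).isHomeomorph

theorem measurableEmbedding_alphaBar (hα : IsAdmissible B B' α) :
    MeasurableEmbedding (alphaBar hα) :=
  (alphaBarHomeomorph hα).measurableEmbedding

theorem bijOn_alphaBar_of_iff (hα : IsAdmissible B B' α) {S : Set B.PathSpace}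
    {S' : Set B'.PathSpace} (h : ∀ x, alphaBar hα x ∈ S' ↔ x ∈ S) :
    BijOn (alphaBar hα) S S' :=
  ⟨fun x hx => (h x).mpr hx, (isHomeomorph_alphaBar hα).injective.injOn, fun z hz =>
    ⟨alphaBar hα.symm z, (h _).mp (by rwa [alphaBar_alphaBar_symm]),
      alphaBar_alphaBar_symm hα z⟩⟩

theorem bijOn_alphaBar_R (hα : IsAdmissible B B' α) (e : E) :
    BijOn (alphaBar hα) (B.R e) (B'.R (α e)) :=
  bijOn_alphaBar_of_iff hα fun _ => α.injective.eq_iff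

theorem alphaBar_mem_D (hα : IsAdmissible B B' α) (e : E) {x : B.PathSpace} :
    alphaBar hα x ∈ B'.D (α e) ↔ x ∈ B.D e :=
  (hα.r_eq_iff _ e).symm

theorem bijOn_alphaBar_D (hα : IsAdmissible B B' α) (e : E) :
    BijOn (alphaBar hα) (B.D e) (B'.D (α e)) :=
  bijOn_alphaBar_of_iff hα fun _ => alphaBar_mem_D hα e

theorem edge_sigma_zero (e : E) (x : B.D e) : (B.sigma e x).edge 0 = e := rfl

theorem edge_sigma_succ (e : E) (x : B.D e) (i : ℕ) :
    (B.sigma e x).edge (i + 1) = x.1.edge i := rfl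

theorem alphaBar_sigma (hα : IsAdmissible B B' α) (e : E) (x : B.D e) :
    alphaBar hα (B.sigma e x) = B'.sigma (α e) ⟨alphaBar hα x.1, (alphaBar_mem_D hα e).mpr x.2⟩ := by
  ext i
  cases i <;> rfl

theorem comap_alphaBar_cylinder (hα : IsAdmissible B B' α) (m' : Measure B'.PathSpace)
    (y : B.PathSpace) (n : ℕ) :
    m'.comap (alphaBar hα) (B.cylinder y n) = m' (B'.cylinder (alphaBar hα y) n) := by
  rw [(measurableEmbedding_alphaBar hα).comap_apply, image_alphaBar_cylinder]

theorem isProbabilityMeasure_comap_alphaBar (hα : IsAdmissible B B' α) (m' : Measure B'.PathSpace)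
    [IsProbabilityMeasure m'] : IsProbabilityMeasure (m'.comap (alphaBar hα)) := by
  constructor
  rw [(measurableEmbedding_alphaBar hα).comap_apply, image_univ,
    (isHomeomorph_alphaBar hα).surjective.range_eq, measure_univ]

/-! ### The edge system as a semibranching function system -/

theorem range_sigma (e : E) : range (B.sigma e) = B.R e := by
  ext x
  constructor
  · rintro ⟨y, rfl⟩
    rfl
  · rintro rfl
    refine ⟨⟨x.shift, (x.r_edge 0).symm⟩, ?_⟩
    ext i
    cases i <;> rfl

theorem isOpen_D (e : E) : IsOpen (B.D e) :=
  isOpen_iff_cylinder.mpr fun x hx => ⟨0, fun y hy => by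
    change B.s (y.edge 0) = B.r e
    rw [s_edge_eq_of_mem_cylinder hy le_rfl]
    exact hx⟩

theorem isOpen_R (e : E) : IsOpen (B.R e) :=
  isOpen_iff_cylinder.mpr fun _ hx => ⟨1, fun _ hy => (hy.2 0 one_pos).trans hx⟩

theorem shift_sigma (e : E) (x : B.D e) : (B.sigma e x).shift = x.1 := by
  ext i
  rfl

theorem sigma_injective (e : E) : Function.Injective (B.sigma e) := fun x y h =>
  Subtype.ext (by rw [← shift_sigma e x, h, shift_sigma])

theorem sigma_mem_cylinder (e : E) {x y : B.D e} {n : ℕ} :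
    B.sigma e x ∈ B.cylinder (B.sigma e y) (n + 1) ↔ x.1 ∈ B.cylinder y.1 n := by
  refine ⟨fun h => ?_, fun h => ⟨rfl, fun i hi => ?_⟩⟩
  · exact mem_cylinder_of_s_edge_eq (x.2.trans y.2.symm) fun i hi => h.2 (i + 1) (by omega)
  · cases i with
    | zero => rfl
    | succ i => exact h.2 i (by omega)

theorem sigma_image_cylinder (e : E) (y : B.D e) (n : ℕ) :
    B.sigma e '' (Subtype.val ⁻¹' B.cylinder y.1 n) = B.cylinder (B.sigma e y) (n + 1) := by
  ext z
  constructor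
  · rintro ⟨x, hx, rfl⟩
    exact (sigma_mem_cylinder e).mpr hx
  · intro hz
    obtain ⟨x, rfl⟩ : z ∈ range (B.sigma e) := by
      rw [range_sigma]
      exact hz.2 0 (Nat.succ_pos n)
    exact ⟨x, (sigma_mem_cylinder e).mp hz, rfl⟩

theorem isOpenEmbedding_sigma (e : E) : IsOpenEmbedding (B.sigma e) := by
  refine .of_continuous_injective_isOpenMap ?_ (sigma_injective e) ?_
  · rw [continuous_iff_continuousAt]
    intro x
    refine (nhds_hasBasis_cylinder _).tendsto_right_iff.mpr fun n _ => ?_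
    have h : Subtype.val ⁻¹' B.cylinder x.1 n ∈ 𝓝 x :=
      ((isOpen_cylinder x.1 n).preimage continuous_subtype_val).mem_nhds (mem_cylinder_self _ n)
    filter_upwards [h] with y hy
    exact cylinder_antitone _ n.le_succ ((sigma_mem_cylinder e).mpr hy)
  · rintro _ ⟨W, hW, rfl⟩
    rw [isOpen_iff_cylinder]
    rintro _ ⟨x, hx, rfl⟩
    obtain ⟨n, hn⟩ := isOpen_iff_cylinder.mp hW x.1 hx
    refine ⟨n + 1, ?_⟩
    rw [← sigma_image_cylinder]
    exact image_mono (preimage_mono hn)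

theorem measurableEmbedding_sigma (e : E) : MeasurableEmbedding (B.sigma e) :=
  (isOpenEmbedding_sigma e).measurableEmbedding

/-- If `σ_e` multiplies the measures of all cylinders in `D_e` by a constant, then `m ∘ σ_e` is
that multiple of `m` on `D_e`. -/
theorem comap_sigma_eq_smul [Finite V] [Finite E] {m : Measure B.PathSpace} [IsFiniteMeasure m]
    {e : E} {c : ℝ≥0∞} (hc : c ≠ ∞)
    (h : ∀ (y : B.D e) n, m (B.cylinder (B.sigma e y) (n + 1)) = c * m (B.cylinder y.1 n)) :
    m.comap (B.sigma e) = c • m.comap (Subtype.val : B.D e → B.PathSpace) := by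
  have hval : MeasurableEmbedding (Subtype.val : B.D e → B.PathSpace) :=
    .subtype_coe (isOpen_D e).measurableSet
  have hσ := measurableEmbedding_sigma e (B := B)
  have hfin1 : IsFiniteMeasure ((m.comap (B.sigma e)).map Subtype.val) := by
    refine ⟨?_⟩
    rw [hval.map_apply, hσ.comap_apply]
    exact measure_lt_top _ _
  have hfin2 : IsFiniteMeasure
      ((c • m.comap (Subtype.val : B.D e → B.PathSpace)).map Subtype.val) := by
    refine ⟨?_⟩
    rw [hval.map_apply, Measure.smul_apply, hval.comap_apply, smul_eq_mul]
    exact ENNReal.mul_lt_top hc.lt_top (measure_lt_top _ _)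
  have key : (m.comap (B.sigma e)).map Subtype.val =
      (c • m.comap (Subtype.val : B.D e → B.PathSpace)).map Subtype.val := by
    refine measure_ext_of_cylinder fun y n => ?_
    rw [hval.map_apply, hval.map_apply, hσ.comap_apply, Measure.smul_apply, hval.comap_apply,
      smul_eq_mul, Subtype.image_preimage_coe]
    by_cases hy : y ∈ B.D e
    · have hsub : B.cylinder y n ⊆ B.D e := fun z hz =>
        (s_edge_eq_of_mem_cylinder hz n.zero_le).trans hy
      rw [inter_eq_self_of_subset_right hsub, sigma_image_cylinder e ⟨y, hy⟩ n]
      exact h ⟨y, hy⟩ n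
    · have hemp : B.D e ∩ B.cylinder y n = ∅ := by
        refine eq_empty_of_forall_notMem fun z hz => hy ?_
        exact (s_edge_eq_of_mem_cylinder hz.2 n.zero_le).symm.trans hz.1
      have hemp' : (Subtype.val ⁻¹' B.cylinder y n : Set (B.D e)) = ∅ := by
        rw [← Subtype.preimage_coe_self_inter, hemp, preimage_empty]
      rw [hemp, hemp', image_empty, measure_empty, mul_zero]
  rw [← hval.comap_map (m.comap (B.sigma e)), key, hval.comap_map]

theorem isSaturatedCKSFS_of_cylinder [Finite V] [Finite E] {m : Measure B.PathSpace}
    [IsProbabilityMeasure m] (hm : ∀ x, m {x} = 0)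
    (h : ∀ e, ∃ c : ℝ≥0∞, c ≠ 0 ∧ c ≠ ∞ ∧ ∀ (y : B.D e) n,
      m (B.cylinder (B.sigma e y) (n + 1)) = c * m (B.cylinder y.1 n)) :
    IsSaturatedCKSFS m B.D B.sigma := by
  choose c hc0 hct hc using h
  have hsmul := fun e => comap_sigma_eq_smul (hct e) (hc e)
  have hval : ∀ e, MeasurableEmbedding (Subtype.val : B.D e → B.PathSpace) := fun e =>
    .subtype_coe (isOpen_D e).measurableSet
  have hfin : ∀ e, IsFiniteMeasure (m.comap (Subtype.val : B.D e → B.PathSpace)) := fun e => by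
    refine ⟨?_⟩
    rw [(hval e).comap_apply]
    exact measure_lt_top _ _
  have hfin' : ∀ e, IsFiniteMeasure (m.comap (B.sigma e)) := fun e => by
    refine ⟨?_⟩
    rw [(measurableEmbedding_sigma e).comap_apply]
    exact measure_lt_top _ _
  have hac : ∀ e, m.comap (B.sigma e) ≪ m.comap (Subtype.val : B.D e → B.PathSpace) := fun e => by
    rw [hsmul e]
    exact Measure.smul_absolutelyContinuous
  have hac' : ∀ e, m.comap (Subtype.val : B.D e → B.PathSpace) ≪ m.comap (B.sigma e) := fun e => by
    rw [hsmul e]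
    exact Measure.absolutelyContinuous_smul (hc0 e)
  exact
  { prob := inferInstance
    nonatomic := hm
    measurableSet := fun e => (isOpen_D e).measurableSet
    embedding := measurableEmbedding_sigma
    disjoint := fun e f hef => by
      rw [range_sigma, range_sigma]
      have : B.R e ∩ B.R f = ∅ := eq_empty_of_forall_notMem fun x hx => hef (hx.1.symm.trans hx.2)
      rw [this, measure_empty]
    cover := by
      have : (⋃ e, range (B.sigma e)) = univ :=
        eq_univ_of_forall fun x => mem_iUnion.mpr ⟨x.edge 0, by rw [range_sigma]; rfl⟩
      rw [this, compl_univ, measure_empty]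
    ac := hac
    rnDeriv_pos := fun e => (hac' e).ae_le (Measure.rnDeriv_pos (hac e))
    coding := ⟨PathSpace.shift, continuous_shift.measurable, fun e =>
      Eventually.of_forall fun x => shift_sigma e x⟩
    saturated := by
      have : (⋃ e, B.D e) = univ := eq_univ_of_forall fun x => by
        obtain ⟨e, he⟩ := B.r_surjective (B.s (x.edge 0))
        exact mem_iUnion.mpr ⟨e, he.symm⟩
      rw [this, compl_univ, measure_empty]
    ck := fun e => by
      refine ⟨{f | B.s f = B.r e}, Eventually.of_forall fun x => propext ?_⟩
      change x ∈ B.D e ↔ x ∈ ⋃ j ∈ {f | B.s f = B.r e}, range (B.sigma j)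
      simp only [range_sigma, mem_iUnion]
      exact ⟨fun hx => ⟨x.edge 0, hx, rfl⟩, by rintro ⟨_, hf, rfl⟩; exact hf⟩ }

theorem _root_.IsSaturatedCKSFS.reindex {X Λ Λ' : Type*} [MeasurableSpace X] [Finite Λ] [Finite Λ']
    {m : Measure X} {D : Λ' → Set X} {σ : ∀ i, D i → X} (h : IsSaturatedCKSFS m D σ)
    (α : Λ ≃ Λ') : IsSaturatedCKSFS m (fun e => D (α e)) (fun e => σ (α e)) where
  prob := h.prob
  nonatomic := h.nonatomic
  measurableSet e := h.measurableSet _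
  embedding e := h.embedding _
  disjoint e f hef := h.disjoint _ _ (α.injective.ne hef)
  cover := by
    rw [α.surjective.iUnion_comp fun e => range (σ e)]
    exact h.cover
  ac e := h.ac _
  rnDeriv_pos e := h.rnDeriv_pos _
  coding := by
    obtain ⟨c, hc, hcσ⟩ := h.coding
    exact ⟨c, hc, fun e => hcσ _⟩
  saturated := by
    rw [α.surjective.iUnion_comp D]
    exact h.saturated
  ck e := by
    obtain ⟨J, hJ⟩ := h.ck (α e)
    refine ⟨α ⁻¹' J, hJ.trans (Eq.eventuallyEq ?_)⟩
    exact (α.surjective.iUnion_comp fun j => ⋃ (_ : j ∈ J), range (σ j)).symm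

theorem alphaBarImplements_of_equiv [Finite E] [Finite E'] (hα : IsAdmissible B B' α)
    {m : Measure B.PathSpace} {m' : Measure B'.PathSpace}
    (hm : IsSaturatedCKSFS m B.D B.sigma) (hm' : IsSaturatedCKSFS m' B'.D B'.sigma)
    (h1 : m ≪ m'.comap (alphaBar hα)) (h2 : m'.comap (alphaBar hα) ≪ m) :
    AlphaBarImplements hα m m' where
  sfs := hm
  sfs' := hm'.reindex α
  measurable := (continuous_alphaBar hα).measurable
  injOn e := ⟨∅, measure_empty, (isHomeomorph_alphaBar hα).injective.injOn⟩
  onto e := Eq.eventuallyEq <| by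
    rw [range_sigma, range_sigma, (bijOn_alphaBar_R hα e).image_eq]
  equiv e A _ hA := by
    rw [← (measurableEmbedding_alphaBar hα).comap_apply]
    exact ⟨fun h => h1 h, fun h => h2 h⟩
  comm e := Eventually.of_forall fun x => ⟨(alphaBar_mem_D hα e).mpr x.2, alphaBar_sigma hα e x⟩

theorem AlphaBarImplements.comap_eq_zero_iff [Finite E] {hα : IsAdmissible B B' α}
    {m : Measure B.PathSpace} {m' : Measure B'.PathSpace} (h : AlphaBarImplements hα m m')
    {A : Set B.PathSpace} (hA : MeasurableSet A) :
    m'.comap (alphaBar hα) A = 0 ↔ m A = 0 := by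
  have hU : A = ⋃ e, A ∩ B.R e := by
    rw [← inter_iUnion, eq_comm, inter_eq_left]
    exact fun x _ => mem_iUnion.mpr ⟨x.edge 0, rfl⟩
  rw [hU, measure_iUnion_null_iff, measure_iUnion_null_iff]
  refine forall_congr' fun e => ?_
  rw [(measurableEmbedding_alphaBar hα).comap_apply]
  exact h.equiv e _ (by rw [range_sigma]; exact inter_subset_right)
    (hA.inter (isOpen_R e).measurableSet)

theorem AlphaBarImplements.absolutelyContinuous [Finite E] {hα : IsAdmissible B B' α}
    {m : Measure B.PathSpace} {m' : Measure B'.PathSpace} (h : AlphaBarImplements hα m m') :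
    m ≪ m'.comap (alphaBar hα) :=
  .mk fun _ hA h0 => (h.comap_eq_zero_iff hA).mp h0

theorem AlphaBarImplements.comap_absolutelyContinuous [Finite E] {hα : IsAdmissible B B' α}
    {m : Measure B.PathSpace} {m' : Measure B'.PathSpace} (h : AlphaBarImplements hα m m') :
    m'.comap (alphaBar hα) ≪ m :=
  .mk fun _ hA h0 => (h.comap_eq_zero_iff hA).mpr h0

end ZeroOneBratteli

/-! ### Tail invariant measures -/

namespace ZeroOneBratteli

variable {V E : Type*} {B : ZeroOneBratteli V E}

open Classical in
/-- The incidence operator `(T f)(v) = ∑ f(r(e))`, the sum over all edges `e` with source `v`. -/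
noncomputable def transfer [Fintype E] (B : ZeroOneBratteli V E) (f : V → ℝ) (v : V) : ℝ :=
  ∑ e with B.s e = v, f (B.r e)

section Transfer

variable [Fintype E]

theorem transfer_mono {f g : V → ℝ} (h : ∀ v, f v ≤ g v) (v : V) :
    B.transfer f v ≤ B.transfer g v :=
  Finset.sum_le_sum fun _ _ => h _

theorem transfer_sub_mul (f g : V → ℝ) (c : ℝ) (v : V) :
    B.transfer (fun w => f w - c * g w) v = B.transfer f v - c * B.transfer g v := by
  simp [transfer, Finset.sum_sub_distrib, Finset.mul_sum]

theorem transfer_const_mul (g : V → ℝ) (c : ℝ) (v : V) :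
    B.transfer (fun w => c * g w) v = c * B.transfer g v := by
  simp [transfer, Finset.mul_sum]

theorem transfer_nonneg {f : V → ℝ} (h : ∀ v, 0 ≤ f v) (v : V) : 0 ≤ B.transfer f v :=
  Finset.sum_nonneg fun _ _ => h _

theorem le_transfer {f : V → ℝ} (h : ∀ v, 0 ≤ f v) (e : E) :
    f (B.r e) ≤ B.transfer f (B.s e) :=
  Finset.single_le_sum (f := fun e => f (B.r e)) (fun _ _ => h _) (by simp)

theorem transfer_iterate_nonneg {f : V → ℝ} (h : ∀ v, 0 ≤ f v) (k : ℕ) (v : V) :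
    0 ≤ (B.transfer^[k] f) v := by
  induction k generalizing v with
  | zero => exact h v
  | succ k ih =>
    rw [Function.iterate_succ_apply']
    exact transfer_nonneg ih v

theorem le_transfer_iterate_of_connected {f : V → ℝ} (h : ∀ v, 0 ≤ f v) {k : ℕ} {v w : V}
    (hvw : B.Connected k v w) : f w ≤ (B.transfer^[k] f) v := by
  induction k generalizing v with
  | zero => exact le_of_eq (congrArg f hvw).symm
  | succ k ih =>
    obtain ⟨e, rfl, he⟩ := hvw
    rw [Function.iterate_succ_apply']
    exact (ih he).trans (le_transfer (transfer_iterate_nonneg h k) e)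

theorem transfer_iterate_le {f : V → ℝ} {C : ℝ} (hC : 0 ≤ C) (h : ∀ v, f v ≤ C) (k : ℕ) (v : V) :
    (B.transfer^[k] f) v ≤ Fintype.card E ^ k * C := by
  induction k generalizing v with
  | zero => simpa using h v
  | succ k ih =>
    classical
    rw [Function.iterate_succ_apply']
    calc B.transfer (B.transfer^[k] f) v
        ≤ ∑ e with B.s e = v, (Fintype.card E : ℝ) ^ k * C := Finset.sum_le_sum fun e _ => ih _
      _ = (Finset.card {e | B.s e = v} : ℝ) * ((Fintype.card E : ℝ) ^ k * C) := by
        rw [Finset.sum_const, nsmul_eq_mul]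
      _ ≤ (Fintype.card E : ℝ) * ((Fintype.card E : ℝ) ^ k * C) := by
        gcongr
        exact Finset.card_le_univ _
      _ = (Fintype.card E : ℝ) ^ (k + 1) * C := by ring

end Transfer

theorem IsSimple.exists_connected (hB : B.IsSimple) : ∃ k, ∀ v w, B.Connected k v w := by
  obtain ⟨m, -, hm⟩ := hB 1 one_pos
  exact ⟨m - 1, hm⟩

/-- A sequence of functions on the vertex sets of the levels with `h_n = T h_{n+1}`; the measures
of the cylinders that end at a given vertex of a given level form such a sequence. -/
def IsHarmonic [Fintype E] (B : ZeroOneBratteli V E) (h : ℕ → V → ℝ) : Prop :=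
  ∀ n v, h n v = B.transfer (h (n + 1)) v

namespace IsHarmonic

variable [Fintype E] {h g : ℕ → V → ℝ}

theorem eq_transfer_iterate (hh : B.IsHarmonic h) (n k : ℕ) :
    h n = B.transfer^[k] (h (n + k)) := by
  induction k with
  | zero => rfl
  | succ k ih =>
    rw [ih, Function.iterate_succ_apply, ← add_assoc]
    congr 1
    exact funext (hh (n + k))

theorem sub_mul (hh : B.IsHarmonic h) (hg : B.IsHarmonic g) (c : ℝ) :
    B.IsHarmonic fun n v => h n v - c * g n v := fun n v => by
  rw [transfer_sub_mul, ← hh, ← hg]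

theorem const_mul (hg : B.IsHarmonic g) (c : ℝ) : B.IsHarmonic fun n v => c * g n v :=
  fun n v => by rw [transfer_const_mul, ← hg]

theorem zero_le_zero_of_le (hh : B.IsHarmonic h) (hg : B.IsHarmonic g) {n : ℕ}
    (hn : ∀ v, h n v ≤ g n v) (v : V) : h 0 v ≤ g 0 v := by
  induction n generalizing v with
  | zero => exact hn v
  | succ n ih => exact ih (fun v => by rw [hh, hg]; exact transfer_mono hn v) v

theorem eq_zero_of_zero_eq_zero (hh : B.IsHarmonic h) (h0 : ∀ n v, 0 ≤ h n v)
    (hz : ∀ v, h 0 v = 0) (n : ℕ) (v : V) : h n v = 0 := by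
  induction n generalizing v with
  | zero => exact hz v
  | succ n ih =>
    obtain ⟨e, rfl⟩ := B.r_surjective v
    refine le_antisymm ?_ (h0 _ _)
    rw [← ih (B.s e), hh n]
    exact le_transfer (h0 (n + 1)) e

/-- On a simple diagram, the values of a nonnegative sequence on one level are comparable, with a
constant that depends on the diagram only. -/
theorem exists_comparison [Fintype V] [Nonempty V] (hB : B.IsSimple) :
    ∃ M : ℝ, 0 < M ∧ ∀ h : ℕ → V → ℝ, B.IsHarmonic h → (∀ n v, 0 ≤ h n v) →
      ∀ n v w, h n v ≤ M * h n w := by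
  obtain ⟨k, hk⟩ := hB.exists_connected
  obtain ⟨e₀, -⟩ := B.s_surjective (Classical.arbitrary V)
  have hE : 0 < Fintype.card E := Fintype.card_pos_iff.mpr ⟨e₀⟩
  have hV : 0 < Fintype.card V := Fintype.card_pos
  refine ⟨(Fintype.card E : ℝ) ^ k * Fintype.card V, by positivity, fun h hh h0 n v w => ?_⟩
  set f := h (n + k) with hf
  have hf0 : ∀ u, 0 ≤ f u := h0 (n + k)
  rw [hh.eq_transfer_iterate n k]
  have h1 : ∀ u, f u ≤ ∑ u, f u := fun u =>
    Finset.single_le_sum (fun u _ => hf0 u) (Finset.mem_univ u)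
  have h2 : ∑ u, f u ≤ Fintype.card V * (B.transfer^[k] f) w := by
    calc ∑ u, f u ≤ ∑ _u : V, (B.transfer^[k] f) w :=
          Finset.sum_le_sum fun u _ => le_transfer_iterate_of_connected hf0 (hk w u)
      _ = _ := by simp
  calc (B.transfer^[k] f) v ≤ (Fintype.card E : ℝ) ^ k * ∑ u, f u :=
        transfer_iterate_le (Finset.sum_nonneg fun u _ => hf0 u) h1 k v
    _ ≤ (Fintype.card E : ℝ) ^ k * (Fintype.card V * (B.transfer^[k] f) w) := by gcongr
    _ = _ := by ring

/-- The uniqueness part of the Perron–Frobenius theorem: on a simple diagram, all nonnegative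
sequences with `h_n = T h_{n+1}` are proportional. If `t` is the largest number with `t g ≤ h`,
then `d = h - t g` vanishes, as otherwise `d` would be bounded below by a multiple of `g`. -/
theorem exists_eq_mul [Fintype V] [Nonempty V] (hB : B.IsSimple) (hh : B.IsHarmonic h)
    (hg : B.IsHarmonic g) (h0 : ∀ n v, 0 ≤ h n v) (g0 : ∀ n v, 0 < g n v) :
    ∃ c : ℝ, ∀ n v, h n v = c * g n v := by
  obtain ⟨M, hM, hcomp⟩ := exists_comparison hB
  let S : Set ℝ := {t | ∀ n v, t * g n v ≤ h n v}
  have hS0 : (0 : ℝ) ∈ S := fun n v => by simpa using h0 n v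
  have hle : ∀ n v, ∀ t ∈ S, t ≤ h n v / g n v := fun n v t ht =>
    (le_div_iff₀ (g0 n v)).mpr (ht n v)
  have hbdd : BddAbove S := ⟨_, hle 0 (Classical.arbitrary V)⟩
  set t := sSup S with ht
  have htS : t ∈ S := fun n v => (le_div_iff₀ (g0 n v)).mp (csSup_le ⟨0, hS0⟩ (hle n v))
  have hd := hh.sub_mul hg t
  set d : ℕ → V → ℝ := fun n v => h n v - t * g n v with hd_def
  have hd0 : ∀ n v, 0 ≤ d n v := fun n v => sub_nonneg.mpr (htS n v)
  refine ⟨t, fun n v => sub_eq_zero.mp (hd.eq_zero_of_zero_eq_zero hd0 ?_ n v)⟩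
  by_contra! hne
  obtain ⟨v₀, hv₀⟩ := hne
  have hpos : 0 < d 0 v₀ := lt_of_le_of_ne (hd0 0 v₀) (Ne.symm hv₀)
  set ε := d 0 v₀ / (2 * M ^ 2 * g 0 v₀) with hε
  have hε0 : 0 < ε := by
    have := g0 0 v₀
    positivity
  have hεg : ∀ n w, ε * g n w ≤ d n w := by
    intro n w
    by_contra! hlt
    have h1 : ∀ u, d n u ≤ (M ^ 2 * ε) * g n u := fun u => by
      calc d n u ≤ M * d n w := hcomp d hd hd0 n u w
        _ ≤ M * (ε * g n w) := by gcongr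
        _ ≤ M * (ε * (M * g n u)) := by
          gcongr
          exact hcomp g hg (fun n v => (g0 n v).le) n w u
        _ = (M ^ 2 * ε) * g n u := by ring
    have h2 : d 0 v₀ ≤ (M ^ 2 * ε) * g 0 v₀ := hd.zero_le_zero_of_le (hg.const_mul _) h1 v₀
    have h3 : (M ^ 2 * ε) * g 0 v₀ = d 0 v₀ / 2 := by
      have := (g0 0 v₀).ne'
      rw [hε]
      field_simp
    linarith
  have h4 : t + ε ∈ S := fun n v => by
    have h5 : ε * g n v ≤ h n v - t * g n v := hεg n v
    linarith
  linarith [le_csSup hbdd h4]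

end IsHarmonic

/-- The measure of the cylinders given by the finite paths from `v₀` to the vertex `v` of level
`n + 1`, read off from one such path; for an invariant measure the choice does not matter. -/
noncomputable def towerMeasure (m : Measure B.PathSpace) (n : ℕ) (v : V) : ℝ :=
  m.real (B.cylinder (PathSpace.exists_s_edge_eq B n v).choose n)

namespace IsTailInvariant

variable {m m₂ : Measure B.PathSpace}

theorem real_cylinder (hm : B.IsTailInvariant m) (y : B.PathSpace) (n : ℕ) :
    m.real (B.cylinder y n) = towerMeasure m n (B.s (y.edge n)) := by
  refine congrArg ENNReal.toReal (hm n _ _ ?_)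
  exact (PathSpace.exists_s_edge_eq B n (B.s (y.edge n))).choose_spec.symm

theorem isHarmonic [Fintype E] [IsFiniteMeasure m] (hm : B.IsTailInvariant m) :
    B.IsHarmonic (towerMeasure m) := by
  classical
  intro n v
  obtain ⟨y, rfl⟩ := PathSpace.exists_s_edge_eq B n v
  rw [← hm.real_cylinder]
  have : Nonempty B.PathSpace := ⟨y⟩
  choose! z hz hze using fun e (he : B.s e = B.s (y.edge n)) => exists_mem_cylinder_edge_eq y n he
  have hU : B.cylinder y n = ⋃ e ∈ Finset.univ.filter fun e => B.s e = B.s (y.edge n),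
      B.cylinder (z e) (n + 1) := by
    ext x
    simp only [Finset.mem_filter, Finset.mem_univ, true_and, mem_iUnion, exists_prop]
    constructor
    · intro hx
      have he : B.s (x.edge n) = B.s (y.edge n) := s_edge_eq_of_mem_cylinder hx le_rfl
      rw [← cylinder_eq_of_mem (hz _ he)] at hx
      refine ⟨x.edge n, he, hx.1, fun i hi => ?_⟩
      rcases Nat.lt_succ_iff_lt_or_eq.mp hi with hi | rfl
      · exact hx.2 i hi
      · exact (hze _ he).symm
    · rintro ⟨e, he, hx⟩
      rw [← cylinder_eq_of_mem (hz e he)]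
      exact cylinder_antitone _ n.le_succ hx
  rw [hU, measureReal_biUnion_finset]
  · refine Finset.sum_congr rfl fun e he => ?_
    rw [hm.real_cylinder, ← PathSpace.r_edge, hze e (by simpa using he)]
  · intro e he f hf hef
    refine disjoint_left.mpr fun x hxe hxf => hef ?_
    rw [← hze e (by simpa using he), ← hze f (by simpa using hf), ← hxe.2 n n.lt_succ_self,
      ← hxf.2 n n.lt_succ_self]
  · exact fun e _ => measurableSet_cylinder _ _

theorem towerMeasure_nonneg (n : ℕ) (v : V) : 0 ≤ towerMeasure m n v := measureReal_nonneg

theorem sum_towerMeasure_zero [Fintype V] [IsProbabilityMeasure m] (hm : B.IsTailInvariant m) :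
    ∑ v, towerMeasure m 0 v = 1 := by
  choose y hy using PathSpace.exists_s_edge_eq B 0
  have h1 : ∀ v, towerMeasure m 0 v = m.real (B.cylinder (y v) 0) := fun v => by
    rw [hm.real_cylinder, hy]
  have hU : (⋃ v, B.cylinder (y v) 0) = univ := eq_univ_of_forall fun x =>
    mem_iUnion.mpr ⟨B.s (x.edge 0), mem_cylinder_of_s_edge_eq (hy _).symm (by simp)⟩
  rw [← probReal_univ (μ := m), ← hU, measureReal_iUnion_fintype]
  · exact Finset.sum_congr rfl fun v _ => h1 v
  · intro v w hvw
    refine disjoint_left.mpr fun x hxv hxw => hvw ?_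
    rw [← hy v, ← hy w, ← s_edge_eq_of_mem_cylinder hxv le_rfl,
      ← s_edge_eq_of_mem_cylinder hxw le_rfl]
  · exact fun v => measurableSet_cylinder _ _

theorem _root_.ZeroOneBratteli.nonempty_of_isProbabilityMeasure (m : Measure B.PathSpace)
    [IsProbabilityMeasure m] : Nonempty V := by
  obtain ⟨x⟩ := m.nonempty_of_neZero
  exact ⟨x.init⟩

theorem comap_alphaBar {V' E' : Type*} {B' : ZeroOneBratteli V' E'} {α : E ≃ E'}
    {m' : Measure B'.PathSpace} (hm' : B'.IsTailInvariant m') (hα : IsAdmissible B B' α) :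
    B.IsTailInvariant (m'.comap (alphaBar hα)) := fun n y z h => by
  rw [comap_alphaBar_cylinder, comap_alphaBar_cylinder]
  exact hm' n _ _ ((hα.s_eq_iff _ _).mp h)

variable [Fintype V] [Fintype E]

theorem towerMeasure_pos [IsProbabilityMeasure m] (hB : B.IsSimple) (hm : B.IsTailInvariant m)
    (n : ℕ) (v : V) : 0 < towerMeasure m n v := by
  have := nonempty_of_isProbabilityMeasure m
  obtain ⟨M, -, hcomp⟩ := IsHarmonic.exists_comparison hB
  refine lt_of_le_of_ne (towerMeasure_nonneg n v) fun h0 => ?_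
  have h1 : ∀ u, towerMeasure m n u ≤ 0 * towerMeasure m n u := fun u => by
    simpa [← h0] using hcomp _ hm.isHarmonic towerMeasure_nonneg n u v
  have h2 : ∀ u, towerMeasure m 0 u ≤ 0 * towerMeasure m 0 u :=
    hm.isHarmonic.zero_le_zero_of_le (hm.isHarmonic.const_mul 0) h1
  have h3 : ∑ v, towerMeasure m 0 v ≤ 0 :=
    Finset.sum_nonpos fun u _ => by simpa using h2 u
  rw [hm.sum_towerMeasure_zero] at h3
  exact absurd h3 (by norm_num)

/-- The tail equivalence relation of a simple stationary diagram is uniquely ergodic. -/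
theorem unique [IsProbabilityMeasure m] [IsProbabilityMeasure m₂] (hB : B.IsSimple)
    (hm : B.IsTailInvariant m) (hm₂ : B.IsTailInvariant m₂) : m = m₂ := by
  have := nonempty_of_isProbabilityMeasure m
  obtain ⟨c, hc⟩ := IsHarmonic.exists_eq_mul hB hm.isHarmonic hm₂.isHarmonic towerMeasure_nonneg
    (hm₂.towerMeasure_pos hB)
  have h1 : c = 1 := by
    have h2 := hm.sum_towerMeasure_zero
    simp_rw [hc, ← Finset.mul_sum, hm₂.sum_towerMeasure_zero] at h2
    simpa using h2
  refine measure_ext_of_cylinder fun y n => ?_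
  rw [← measureReal_eq_measureReal_iff, hm.real_cylinder, hm₂.real_cylinder, hc, h1, one_mul]

/-- Passing to the next level multiplies the invariant measures of the cylinders by a constant
(the reciprocal of the Perron–Frobenius eigenvalue), because the shifted sequence is proportional to the
original one. -/
theorem isSaturatedCKSFS [IsProbabilityMeasure m] (hB : B.IsSimple) (hm : B.IsTailInvariant m)
    (hna : ∀ x, m {x} = 0) : IsSaturatedCKSFS m B.D B.sigma := by
  have := nonempty_of_isProbabilityMeasure m
  obtain ⟨c, hc⟩ := IsHarmonic.exists_eq_mul (h := fun n => towerMeasure m (n + 1)) hB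
    (fun n v => hm.isHarmonic (n + 1) v) hm.isHarmonic (fun n v => towerMeasure_nonneg (n + 1) v)
    (hm.towerMeasure_pos hB)
  have hc0 : 0 < c := by
    have h1 := hm.towerMeasure_pos hB 1 (Classical.arbitrary V)
    have h2 := hc 0 (Classical.arbitrary V)
    exact pos_of_mul_pos_left (h2 ▸ h1) (towerMeasure_nonneg _ _)
  refine isSaturatedCKSFS_of_cylinder hna fun e => ⟨ENNReal.ofReal c, by simpa using hc0,
    ENNReal.ofReal_ne_top, fun y n => ?_⟩
  rw [← ofReal_measureReal, ← ofReal_measureReal (s := B.cylinder y.1 n),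
    ← ENNReal.ofReal_mul hc0.le, hm.real_cylinder, hm.real_cylinder, edge_sigma_succ]
  exact congrArg ENNReal.ofReal (hc n _)

end IsTailInvariant

end ZeroOneBratteli

/-! ### Markov measures -/

namespace ZeroOneBratteli

variable {V E V' E' : Type*} {B : ZeroOneBratteli V E} {B' : ZeroOneBratteli V' E'} {α : E ≃ E'}
  [Fintype V] [Fintype E] [Fintype V'] [Fintype E']
  {m : Measure B.PathSpace} {m' : Measure B'.PathSpace} {P : B.MarkovData} {P' : B'.MarkovData}

theorem MarkovData.p_pos (P : B.MarkovData) (n : ℕ) (e : E) : 0 < P.p n (B.s e) e :=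
  (P.p_pos_iff n _ e).mpr rfl

namespace IsMarkovMeasure

theorem cylinder_ne_zero (hm : IsMarkovMeasure m P) (y : B.PathSpace) (n : ℕ) :
    m (B.cylinder y n) ≠ 0 := by
  rw [hm y n]
  exact (ENNReal.ofReal_pos.mpr
    (mul_pos (P.p₀_pos _) (Finset.prod_pos fun i _ => P.p_pos i _))).ne'

theorem cylinder_succ (hm : IsMarkovMeasure m P) (y : B.PathSpace) (n : ℕ) :
    m (B.cylinder y (n + 1)) =
      ENNReal.ofReal (P.p n (B.s (y.edge n)) (y.edge n)) * m (B.cylinder y n) := by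
  rw [hm, hm, Finset.prod_range_succ, ← mul_assoc, mul_comm,
    ENNReal.ofReal_mul (P.p_pos _ _).le]

/-- On the cylinders around `x`, the ratios of `m' ∘ ᾱ` to `m` are, up to the constant that comes
from the edges at `v₀`, the partial products of the infinite product. -/
theorem ratioProductConverges_iff (hm : IsMarkovMeasure m P) (hm' : IsMarkovMeasure m' P')
    (hα : IsAdmissible B B' α) (x : B.PathSpace) :
    RatioProductConverges α P P' x ↔ ∃ L : ℝ≥0∞, L ≠ 0 ∧ L ≠ ∞ ∧
      Tendsto (fun n => m'.comap (alphaBar hα) (B.cylinder x n) / m (B.cylinder x n))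
        atTop (𝓝 L) := by
  set c := P'.p₀ (alphaBar hα x).init / P.p₀ x.init with hc
  have hc0 : 0 < c := div_pos (P'.p₀_pos _) (P.p₀_pos _)
  set q : ℕ → ℝ := fun n => ∏ i ∈ Finset.range n,
    P'.p i (B'.s (α (x.edge i))) (α (x.edge i)) / P.p i (B.s (x.edge i)) (x.edge i) with hq
  have hq0 : ∀ n, 0 < q n := fun n =>
    Finset.prod_pos fun i _ => div_pos (P'.p_pos i _) (P.p_pos i _)
  have hquot : (fun n => m'.comap (alphaBar hα) (B.cylinder x n) / m (B.cylinder x n)) =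
      fun n => ENNReal.ofReal (c * q n) := by
    funext n
    rw [comap_alphaBar_cylinder, hm, hm', ← ENNReal.ofReal_div_of_pos
      (mul_pos (P.p₀_pos _) (Finset.prod_pos fun i _ => P.p_pos i _)), mul_div_mul_comm,
      ← Finset.prod_div_distrib]
    rfl
  rw [hquot]
  constructor
  · rintro ⟨L, hL, hlim⟩
    exact ⟨ENNReal.ofReal (c * L), by simpa using mul_pos hc0 hL, ENNReal.ofReal_ne_top,
      ENNReal.tendsto_ofReal (hlim.const_mul c)⟩
  · rintro ⟨L, hL0, hLt, hlim⟩
    refine ⟨L.toReal / c, div_pos (ENNReal.toReal_pos hL0 hLt) hc0, ?_⟩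
    refine (((ENNReal.tendsto_toReal hLt).comp hlim).div_const c).congr fun n => ?_
    rw [Function.comp_apply, ENNReal.toReal_ofReal (mul_pos hc0 (hq0 n)).le,
      mul_div_cancel_left₀ _ hc0.ne']

theorem ae_ratioProductConverges [IsProbabilityMeasure m] [IsProbabilityMeasure m']
    (hm : IsMarkovMeasure m P) (hm' : IsMarkovMeasure m' P') {hα : IsAdmissible B B' α}
    (h : AlphaBarImplements hα m m') : ∀ᵐ x ∂m, RatioProductConverges α P P' x := by
  have := isProbabilityMeasure_comap_alphaBar hα m'
  filter_upwards [ae_exists_tendsto_measure_div_of_absolutelyContinuous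
    hm.cylinder_ne_zero h.absolutelyContinuous] with x hx
  exact (hm.ratioProductConverges_iff hm' hα x).mpr hx

theorem alphaBarImplements [IsProbabilityMeasure m] [IsProbabilityMeasure m']
    (hm : IsMarkovMeasure m P) (hm' : IsMarkovMeasure m' P') (hα : IsAdmissible B B' α)
    (hs : IsSaturatedCKSFS m B.D B.sigma) (hs' : IsSaturatedCKSFS m' B'.D B'.sigma)
    (h1 : ∀ᵐ x ∂m, RatioProductConverges α P P' x)
    (h2 : ∀ᵐ x ∂(m'.comap (alphaBar hα)), RatioProductConverges α P P' x) :
    AlphaBarImplements hα m m' := by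
  have := isProbabilityMeasure_comap_alphaBar hα m'
  refine alphaBarImplements_of_equiv hα hs hs' ?_ ?_
  · refine absolutelyContinuous_of_ae_tendsto_measure_div
      (fun y n => ?_) (h1.mono fun x hx => ?_)
    · rw [comap_alphaBar_cylinder]
      exact hm'.cylinder_ne_zero _ n
    obtain ⟨L, hL0, -, hlim⟩ := (hm.ratioProductConverges_iff hm' hα x).mp hx
    refine ⟨L⁻¹, ENNReal.inv_ne_top.mpr hL0, (tendsto_inv_iff.mpr hlim).congr fun n => ?_⟩
    exact ENNReal.inv_div (Or.inl (measure_ne_top _ _)) (Or.inl (hm.cylinder_ne_zero x n))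
  · refine absolutelyContinuous_of_ae_tendsto_measure_div hm.cylinder_ne_zero
      (h2.mono fun x hx => ?_)
    obtain ⟨L, -, hLt, hlim⟩ := (hm.ratioProductConverges_iff hm' hα x).mp hx
    exact ⟨L, hLt, hlim⟩

/-! ### Stationary Markov measures -/

theorem isSaturatedCKSFS [IsProbabilityMeasure m] (hm : IsMarkovMeasure m P)
    (hP : P.IsStationary) (hna : ∀ x, m {x} = 0) : IsSaturatedCKSFS m B.D B.sigma := by
  refine isSaturatedCKSFS_of_cylinder hna fun e => ?_
  have hc : 0 < P.p₀ (B.s e) * P.p 0 (B.s e) e / P.p₀ (B.r e) :=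
    div_pos (mul_pos (P.p₀_pos _) (P.p_pos 0 e)) (P.p₀_pos _)
  refine ⟨_, (ENNReal.ofReal_pos.mpr hc).ne', ENNReal.ofReal_ne_top, fun y n => ?_⟩
  have h0 := (P.p₀_pos (B.r e)).ne'
  have hy : y.1.init = B.r e := y.1.init_eq.trans y.2
  have hi : (B.sigma e y).init = B.s e := rfl
  rw [hm, hm, ← ENNReal.ofReal_mul hc.le, Finset.prod_range_succ', hy, hi]
  simp only [edge_sigma_succ, edge_sigma_zero, hP _]
  congr 1
  field_simp

theorem pow_mul_cylinder_le (hm : IsMarkovMeasure m P) {δ : ℝ≥0∞}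
    (hδ : ∀ n e, δ ≤ ENNReal.ofReal (P.p n (B.s e) e)) (y : B.PathSpace) (n j : ℕ) :
    δ ^ j * m (B.cylinder y n) ≤ m (B.cylinder y (n + j)) := by
  induction j with
  | zero => simp
  | succ j ih =>
    rw [← add_assoc, hm.cylinder_succ, pow_succ', mul_assoc]
    exact mul_le_mul' (hδ _ _) ih

/-- For a stationary Markov measure on a simple diagram, almost every path runs through any given
edge infinitely often: from any cylinder, a definite part of the mass passes through the edge
within a bounded number of steps, so that the set of paths that avoid the edge from some level on
has no point of density. -/
theorem ae_frequently_edge_eq [IsProbabilityMeasure m] (hB : B.IsSimple)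
    (hm : IsMarkovMeasure m P) (hP : P.IsStationary) (e : E) :
    ∀ᵐ x ∂m, ∃ᶠ n in atTop, x.edge n = e := by
  obtain ⟨k, hk⟩ := hB.exists_connected
  have : Nonempty E := ⟨e⟩
  obtain ⟨e₀, he₀⟩ := Finite.exists_min fun f => P.p 0 (B.s f) f
  set δ := ENNReal.ofReal (P.p 0 (B.s e₀) e₀) with hδ
  have hδ0 : δ ≠ 0 := (ENNReal.ofReal_pos.mpr (P.p_pos 0 e₀)).ne'
  have hδle : ∀ n f, δ ≤ ENNReal.ofReal (P.p n (B.s f) f) := fun n f => by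
    rw [hP n]
    exact ENNReal.ofReal_le_ofReal (he₀ f)
  let A : ℕ → Set B.PathSpace := fun N => {x | ∀ n ≥ N, x.edge n ≠ e}
  have hA : ∀ N, m (A N) = 0 := by
    intro N
    refine ENNReal.eq_zero_of_le_mul_of_lt_one (measure_ne_top _ _) (c := 1 - δ ^ (k + 1))
      (ENNReal.sub_lt_self ENNReal.one_ne_top one_ne_zero (pow_ne_zero _ hδ0)) ?_
    have key : ∀ x ∈ A N, ∃ᶠ n in atTop, m.restrict (A N) (B.cylinder x n) ≤
        (1 - δ ^ (k + 1)) * m (B.cylinder x n) := by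
      intro x _
      refine ((eventually_ge_atTop N).mono fun n hn => ?_).frequently
      obtain ⟨w, hw, hwk⟩ := PathSpace.exists_of_connected (hk (B.s (x.edge n)) (B.s e))
      set z := PathSpace.splice x w n hw.symm with hz
      have hzx : z ∈ B.cylinder x n := splice_mem_cylinder hw.symm
      have hze : z.edge (n + k) = e := (PathSpace.splice_edge_add hw.symm k).trans hwk
      have hsub : B.cylinder z (n + (k + 1)) ⊆ B.cylinder x n := by
        rw [← cylinder_eq_of_mem hzx]
        exact cylinder_antitone z (by omega)
      have hinter : B.cylinder x n ∩ A N ⊆ B.cylinder x n \ B.cylinder z (n + (k + 1)) :=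
        fun u hu => ⟨hu.1, fun huz => hu.2 (n + k) (by omega)
          ((huz.2 (n + k) (by omega)).trans hze)⟩
      rw [Measure.restrict_apply (measurableSet_cylinder x n)]
      calc m (B.cylinder x n ∩ A N)
          ≤ m (B.cylinder x n \ B.cylinder z (n + (k + 1))) := measure_mono hinter
        _ = m (B.cylinder x n) - m (B.cylinder z (n + (k + 1))) :=
          measure_sdiff hsub (measurableSet_cylinder _ _).nullMeasurableSet (measure_ne_top _ _)
        _ ≤ m (B.cylinder x n) - δ ^ (k + 1) * m (B.cylinder x n) := by
          refine tsub_le_tsub_left ?_ _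
          rw [← cylinder_eq_of_mem hzx]
          exact hm.pow_mul_cylinder_le hδle z n (k + 1)
        _ = (1 - δ ^ (k + 1)) * m (B.cylinder x n) := by
          rw [ENNReal.sub_mul fun _ _ => measure_ne_top _ _, one_mul]
    have h1 := measure_le_mul_of_frequently_cylinder (by simp) key
    rwa [Measure.restrict_apply_self] at h1
  have h1 : ∀ᵐ x ∂m, x ∉ ⋃ N, A N := measure_eq_zero_iff_ae_notMem.mp (measure_iUnion_null hA)
  filter_upwards [h1] with x hx hev
  obtain ⟨N, hN⟩ := eventually_atTop.mp hev
  exact hx (mem_iUnion.mpr ⟨N, hN⟩)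

/-- The factors of a convergent product tend to `1`. In the stationary case the factor of each edge
recurs infinitely often, so it is equal to `1`. -/
theorem p_eq_of_ae_ratioProductConverges [IsProbabilityMeasure m] (hB : B.IsSimple)
    (hm : IsMarkovMeasure m P) (hP : P.IsStationary) (hP' : P'.IsStationary)
    (h : ∀ᵐ x ∂m, RatioProductConverges α P P' x) (e : E) :
    P'.p 0 (B'.s (α e)) (α e) = P.p 0 (B.s e) e := by
  obtain ⟨x, hfreq, L, hL, hlim⟩ := ((hm.ae_frequently_edge_eq hB hP e).and h).exists
  have h1 : Tendsto (fun n => P'.p n (B'.s (α (x.edge n))) (α (x.edge n)) /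
      P.p n (B.s (x.edge n)) (x.edge n)) atTop (𝓝 1) := by
    have h2 := ((tendsto_add_atTop_iff_nat 1).mpr hlim).div hlim hL.ne'
    rw [div_self hL.ne'] at h2
    refine h2.congr fun n => ?_
    rw [Pi.div_apply, Finset.prod_range_succ, mul_div_cancel_left₀]
    exact (Finset.prod_pos fun i _ => div_pos (P'.p_pos i _) (P.p_pos i _)).ne'
  have h2 : P'.p 0 (B'.s (α e)) (α e) / P.p 0 (B.s e) e = 1 := by
    by_contra hne
    obtain ⟨n, hn, hn'⟩ := (hfreq.and_eventually (h1.eventually_ne (Ne.symm hne))).exists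
    rw [hn, hP n, hP' n] at hn'
    exact hn' rfl
  exact (div_eq_one_iff_eq (P.p_pos 0 e).ne').mp h2

theorem _root_.ZeroOneBratteli.ratioProductConverges_of_p_eq (hP : P.IsStationary)
    (hP' : P'.IsStationary) (h : ∀ e, P'.p 0 (B'.s (α e)) (α e) = P.p 0 (B.s e) e)
    (x : B.PathSpace) : RatioProductConverges α P P' x := by
  refine ⟨1, one_pos, tendsto_const_nhds.congr fun n => (Finset.prod_eq_one fun i _ => ?_).symm⟩
  rw [hP i, hP' i, h, div_self (P.p_pos 0 _).ne']

end IsMarkovMeasure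

end ZeroOneBratteli

/-! ### Isomorphisms of the edge systems -/

theorem mainTheorem3 {V E V' E' : Type*} [Fintype V] [Fintype E] [Fintype V'] [Fintype E']
    (B : ZeroOneBratteli V E) (B' : ZeroOneBratteli V' E') (hB : B.IsSimple) (hB' : B'.IsSimple)
    (α : E ≃ E') (hα : ZeroOneBratteli.IsAdmissible B B' α) :
    -- the induced map is a homeomorphism that intertwines the edge systems
    IsHomeomorph (ZeroOneBratteli.alphaBar hα) ∧
    (∀ e, BijOn (ZeroOneBratteli.alphaBar hα) (B.R e) (B'.R (α e))) ∧
    (∀ e, BijOn (ZeroOneBratteli.alphaBar hα) (B.D e) (B'.D (α e))) ∧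
    (∀ (e : E) (x : B.D e), ∃ h : ZeroOneBratteli.alphaBar hα x.1 ∈ B'.D (α e),
      ZeroOneBratteli.alphaBar hα (B.sigma e x) =
        B'.sigma (α e) ⟨ZeroOneBratteli.alphaBar hα x.1, h⟩) ∧
    ∀ (m : Measure B.PathSpace) (m' : Measure B'.PathSpace)
      [IsProbabilityMeasure m] [IsProbabilityMeasure m'],
      (∀ x, m {x} = 0) → (∀ x, m' {x} = 0) →
      -- invariant measures
      (B.IsTailInvariant m → B'.IsTailInvariant m' →
        (ZeroOneBratteli.AlphaBarImplements hα m m' ↔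
          m'.comap (ZeroOneBratteli.alphaBar hα) = m)) ∧
      -- stationary Markov measures
      (∀ (P : B.MarkovData) (P' : B'.MarkovData), P.IsStationary → P'.IsStationary →
        ZeroOneBratteli.IsMarkovMeasure m P → ZeroOneBratteli.IsMarkovMeasure m' P' →
        (ZeroOneBratteli.AlphaBarImplements hα m m' ↔
          ∀ e, P'.p 0 (B'.s (α e)) (α e) = P.p 0 (B.s e) e)) ∧
      -- general Markov measures for which the edge systems are semibranching function systems
      (∀ (P : B.MarkovData) (P' : B'.MarkovData),
        ZeroOneBratteli.IsMarkovMeasure m P → ZeroOneBratteli.IsMarkovMeasure m' P' →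
        IsSaturatedCKSFS m B.D B.sigma → IsSaturatedCKSFS m' B'.D B'.sigma →
        (ZeroOneBratteli.AlphaBarImplements hα m m' ↔
          (∀ᵐ x ∂m, ZeroOneBratteli.RatioProductConverges α P P' x) ∧
          (∀ᵐ x ∂(m'.comap (ZeroOneBratteli.alphaBar hα)),
            ZeroOneBratteli.RatioProductConverges α P P' x))) ∧
      -- the three cases together, for arbitrary Markov measures
      ((∃ P : B.MarkovData, ZeroOneBratteli.IsMarkovMeasure m P) →
        (∃ P' : B'.MarkovData, ZeroOneBratteli.IsMarkovMeasure m' P') →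
        IsSaturatedCKSFS m B.D B.sigma → IsSaturatedCKSFS m' B'.D B'.sigma →
        (ZeroOneBratteli.AlphaBarImplements hα m m' ↔
          (B.IsTailInvariant m ∧ B'.IsTailInvariant m' ∧
            m'.comap (ZeroOneBratteli.alphaBar hα) = m) ∨
          (∃ (P : B.MarkovData) (P' : B'.MarkovData), P.IsStationary ∧ P'.IsStationary ∧
            ZeroOneBratteli.IsMarkovMeasure m P ∧ ZeroOneBratteli.IsMarkovMeasure m' P' ∧
            ∀ e, P'.p 0 (B'.s (α e)) (α e) = P.p 0 (B.s e) e) ∨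
          (∃ (P : B.MarkovData) (P' : B'.MarkovData),
            ZeroOneBratteli.IsMarkovMeasure m P ∧ ZeroOneBratteli.IsMarkovMeasure m' P' ∧
            (∀ᵐ x ∂m, ZeroOneBratteli.RatioProductConverges α P P' x) ∧
            (∀ᵐ x ∂(m'.comap (ZeroOneBratteli.alphaBar hα)),
              ZeroOneBratteli.RatioProductConverges α P P' x)))) := by
  open ZeroOneBratteli in
  refine ⟨isHomeomorph_alphaBar hα, bijOn_alphaBar_R hα, bijOn_alphaBar_D hα,
    fun e x => ⟨(alphaBar_mem_D hα e).mpr x.2, alphaBar_sigma hα e x⟩, ?_⟩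
  intro m m' _ _ hna hna'
  have := isProbabilityMeasure_comap_alphaBar hα m'
  have hinv : B.IsTailInvariant m → B'.IsTailInvariant m' →
      (AlphaBarImplements hα m m' ↔ m'.comap (alphaBar hα) = m) := fun hm hm' =>
    ⟨fun _ => (hm'.comap_alphaBar hα).unique hB hm, fun h =>
      alphaBarImplements_of_equiv hα (hm.isSaturatedCKSFS hB hna) (hm'.isSaturatedCKSFS hB' hna')
        (by rw [h]) (by rw [h])⟩
  have hstat : ∀ (P : B.MarkovData) (P' : B'.MarkovData), P.IsStationary → P'.IsStationary →
      IsMarkovMeasure m P → IsMarkovMeasure m' P' →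
      (AlphaBarImplements hα m m' ↔ ∀ e, P'.p 0 (B'.s (α e)) (α e) = P.p 0 (B.s e) e) :=
    fun P P' hP hP' hm hm' =>
    ⟨fun h => hm.p_eq_of_ae_ratioProductConverges hB hP hP' (hm.ae_ratioProductConverges hm' h),
      fun h => hm.alphaBarImplements hm' hα (hm.isSaturatedCKSFS hP hna)
        (hm'.isSaturatedCKSFS hP' hna')
        (Eventually.of_forall (ratioProductConverges_of_p_eq hP hP' h))
        (Eventually.of_forall (ratioProductConverges_of_p_eq hP hP' h))⟩
  have hmarkov : ∀ (P : B.MarkovData) (P' : B'.MarkovData),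
      IsMarkovMeasure m P → IsMarkovMeasure m' P' →
      IsSaturatedCKSFS m B.D B.sigma → IsSaturatedCKSFS m' B'.D B'.sigma →
      (AlphaBarImplements hα m m' ↔ (∀ᵐ x ∂m, RatioProductConverges α P P' x) ∧
        ∀ᵐ x ∂(m'.comap (alphaBar hα)), RatioProductConverges α P P' x) :=
    fun P P' hm hm' hs hs' =>
    ⟨fun h => ⟨hm.ae_ratioProductConverges hm' h,
      h.comap_absolutelyContinuous.ae_le (hm.ae_ratioProductConverges hm' h)⟩,
      fun h => hm.alphaBarImplements hm' hα hs hs' h.1 h.2⟩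
  refine ⟨hinv, hstat, hmarkov, ?_⟩
  rintro ⟨P, hm⟩ ⟨P', hm'⟩ hs hs'
  constructor
  · intro h
    exact Or.inr (Or.inr ⟨P, P', hm, hm', (hmarkov P P' hm hm' hs hs').mp h⟩)
  · rintro (⟨h1, h2, h⟩ | ⟨Q, Q', hQ, hQ', h1, h2, h⟩ | ⟨Q, Q', h1, h2, h⟩)
    · exact (hinv h1 h2).mpr h
    · exact (hstat Q Q' hQ hQ' h1 h2).mpr h
    · exact (hmarkov Q Q' h1 h2 hs hs').mpr h
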